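/- **Setting.** Let $n\ge 2$ be an integer, $\beta>0$, $R>0$, and let $p=p_{\mathrm{Str}}(n)$ be the Strauss exponent, i.e. the positive root of $(n-1)p^2-(n+1)p-2=0$. Write $B_r$ for the ball of radius $r$ around the origin of $\mathbb R^n$. Functions are real valued, pointwise conditions on $L^2$ functions hold almost everywhere, and derivatives in $x$ are weak. For $\varepsilon>0$ consider $$\beta u_{ttt}+u_{tt}-\Delta u-\beta\Delta u_t=|u|^p\quad (x\in\mathbb R^n,\ t>0),\qquad (u,u_t,u_{tt})(0,\cdot)=\varepsilon(u_0,u_1,u_2),$$ with $(u_0,u_1,u_2)\in H^2(\mathbb R^n)\times H^1(\mathbb R^n)\times L^2(\mathbb R^n)$. **Energy solutions.** For $0<T\le\infty$, a function $$u\in \mathcal C([0,T),H^2(\mathbb R^n))\cap \mathcal C^1([0,T),H^1(\mathbb R^n))\cap \mathcal C^2([0,T),L^2(\mathbb R^n))\cap L^p_{\mathrm{loc}}([0,T)\times\mathbb R^n)$$ is an energy solution on $[0,T)$ if $u(0,\cdot)=\varepsilon u_0$ and, for every $\psi\in \mathcal C_0^\infty([0,T)\times\mathbb R^n)$ and every $t\in[0,T)$,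 $$\begin{aligned} &\int_{\mathbb R^n} u_t(t,x)\psi(t,x)\,dx-\varepsilon\int_{\mathbb R^n} u_1(x)\psi(0,x)\,dx+\int_0^t\!\int_{\mathbb R^n}\big(\nabla_x u(s,x)\cdot\nabla_x\psi(s,x)-u_t(s,x)\psi_s(s,x)\big)\,dx\,ds\\ &\quad=\varepsilon\int_0^t e^{-s/\beta}\int_{\mathbb R^n}\psi(s,x)\big(u_2(x)-\Delta u_0(x)\big)\,dx\,ds+\frac1\beta\int_0^t\!\int_0^s e^{(\tau-s)/\beta}\int_{\mathbb R^n}\psi(s,x)|u(\tau,x)|^p\,dx\,d\tau\,ds . \end{aligned}$$ **Theorem.** Assume that $u_0,u_1,u_2$ are nonnegative with supports contained in $B_R$, that $u_0\not\equiv0$, and that $u_2-\Delta u_0\ge 0$. Then there exist a constant $\varepsilon_0>0$, depending only on $u_0,u_1,n,p,R,\beta$, and a constant $C>0$, independent of $\varepsilon$, such that for every $\varepsilon\in(0,\varepsilon_0]$ the following holds. If $0<T\le\infty$ and $u$ is an energy solution on $[0,T)$ with $\operatorname{supp}u(t,\cdot)\subset B_{R+t}$ for all $t\in(0,T)$, then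 $$T<\infty\qquad\text{and}\qquad T\le \exp\!\big(C\varepsilon^{-p(p-1)}\big).$$ In other words, such solutions blow up in finite time (none is global), and their lifespan satisfies $T(\varepsilon)\le\exp(C\varepsilon^{-p(p-1)})$. -/

import Mathlib

open MeasureTheory Set
open scoped ContDiff ENNReal

noncomputable section

namespace MGT

/-- `ℝⁿ` with its Euclidean norm and Lebesgue measure. -/
abbrev Space (n : ℕ) : Type := EuclideanSpace ℝ (Fin n)

/-- The real Hilbert space `L²(ℝⁿ)`. -/
abbrev L2 (n : ℕ) : Type := Lp ℝ 2 (volume : Measure (Space n))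

/-- The classical partial derivative in the `i`-th coordinate direction. -/
def pderiv {n : ℕ} (i : Fin n) (φ : Space n → ℝ) (x : Space n) : ℝ :=
  fderiv ℝ φ x (EuclideanSpace.single i 1)

/-- `g` is the `i`-th weak partial derivative of `f` (both in `L²(ℝⁿ)`). -/
def IsWeakDeriv {n : ℕ} (i : Fin n) (f g : L2 n) : Prop :=
  ∀ φ : Space n → ℝ, ContDiff ℝ ∞ φ → HasCompactSupport φ →
    ∫ x, f x * pderiv i φ x = -∫ x, g x * φ x

lemma continuous_pderiv {n : ℕ} (i : Fin n) {φ : Space n → ℝ} (h : ContDiff ℝ ∞ φ) :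
    Continuous (pderiv i φ) :=
  (h.continuous_fderiv (by simp)).clm_apply continuous_const

lemma hasCompactSupport_pderiv {n : ℕ} (i : Fin n) {φ : Space n → ℝ}
    (h : HasCompactSupport φ) : HasCompactSupport (pderiv i φ) :=
  h.fderiv_apply (𝕜 := ℝ) (EuclideanSpace.single i 1)

lemma integrable_mul_of_hasCompactSupport {n : ℕ} (f : L2 n) {φ : Space n → ℝ}
    (h : Continuous φ) (hc : HasCompactSupport φ) : Integrable (fun x => f x * φ x) :=
  (Lp.memLp f).integrable_mul (q := 2) (h.memLp_of_hasCompactSupport hc)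

lemma IsWeakDeriv.add {n : ℕ} {i : Fin n} {f g f' g' : L2 n}
    (h : IsWeakDeriv i f g) (h' : IsWeakDeriv i f' g') : IsWeakDeriv i (f + f') (g + g') := by
  intro φ hφ hc
  have e1 : ∫ x, (f + f') x * pderiv i φ x
      = ∫ x, (f x * pderiv i φ x + f' x * pderiv i φ x) := by
    refine integral_congr_ae ?_
    filter_upwards [Lp.coeFn_add f f'] with x hx
    rw [hx, Pi.add_apply, add_mul]
  have e2 : ∫ x, (g + g') x * φ x = ∫ x, (g x * φ x + g' x * φ x) := by
    refine integral_congr_ae ?_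
    filter_upwards [Lp.coeFn_add g g'] with x hx
    rw [hx, Pi.add_apply, add_mul]
  rw [e1, e2, integral_add, integral_add, h φ hφ hc, h' φ hφ hc]
  · ring
  · exact integrable_mul_of_hasCompactSupport g hφ.continuous hc
  · exact integrable_mul_of_hasCompactSupport g' hφ.continuous hc
  · exact integrable_mul_of_hasCompactSupport f (continuous_pderiv i hφ)
      (hasCompactSupport_pderiv i hc)
  · exact integrable_mul_of_hasCompactSupport f' (continuous_pderiv i hφ)
      (hasCompactSupport_pderiv i hc)

lemma IsWeakDeriv.smul {n : ℕ} {i : Fin n} {f g : L2 n} (c : ℝ)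
    (h : IsWeakDeriv i f g) : IsWeakDeriv i (c • f) (c • g) := by
  intro φ hφ hc
  have e1 : ∫ x, (c • f) x * pderiv i φ x = ∫ x, c * (f x * pderiv i φ x) := by
    refine integral_congr_ae ?_
    filter_upwards [Lp.coeFn_smul c f] with x hx
    rw [hx, Pi.smul_apply, smul_eq_mul, mul_assoc]
  have e2 : ∫ x, (c • g) x * φ x = ∫ x, c * (g x * φ x) := by
    refine integral_congr_ae ?_
    filter_upwards [Lp.coeFn_smul c g] with x hx
    rw [hx, Pi.smul_apply, smul_eq_mul, mul_assoc]
  rw [e1, e2, integral_const_mul, integral_const_mul, h φ hφ hc, mul_neg]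

lemma IsWeakDeriv.zero {n : ℕ} (i : Fin n) : IsWeakDeriv i (0 : L2 n) 0 := by
  have h0 : ∀ ψ : Space n → ℝ, ∫ x, (0 : L2 n) x * ψ x = 0 := by
    intro ψ
    refine integral_eq_zero_of_ae ?_
    filter_upwards [Lp.coeFn_zero ℝ 2 (volume : Measure (Space n))] with x hx
    rw [hx]
    simp
  intro φ _ _
  rw [h0, h0, neg_zero]

/-- The Sobolev space `H¹(ℝⁿ)`: a function in `L²` together with its weak gradient in `L²`.
Weak derivatives are unique, so the second component carries no additional data; the norm
inherited from the product is equivalent to the usual Sobolev norm. -/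
def H1Submodule (n : ℕ) : Submodule ℝ (L2 n × (Fin n → L2 n)) where
  carrier := {v | ∀ i, IsWeakDeriv i v.1 (v.2 i)}
  add_mem' h h' i := (h i).add (h' i)
  zero_mem' i := IsWeakDeriv.zero i
  smul_mem' c _ h i := (h i).smul c

/-- `H¹(ℝⁿ)` as a normed space. -/
abbrev H1 (n : ℕ) : Type := H1Submodule n

/-- The element of `L²` underlying an element of `H¹`. -/
def H1.toL2 {n : ℕ} (v : H1 n) : L2 n := v.1.1

/-- The weak partial derivatives of an element of `H¹`. -/
def H1.grad {n : ℕ} (v : H1 n) (i : Fin n) : L2 n := v.1.2 i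

/-- The Sobolev space `H²(ℝⁿ)`: a function in `L²` together with its weak partial derivatives,
which lie in `H¹`. The inherited norm is equivalent to the usual Sobolev norm. -/
def H2Submodule (n : ℕ) : Submodule ℝ (L2 n × (Fin n → H1 n)) where
  carrier := {w | ∀ i, IsWeakDeriv i w.1 (H1.toL2 (w.2 i))}
  add_mem' h h' i := (h i).add (h' i)
  zero_mem' i := IsWeakDeriv.zero i
  smul_mem' c _ h i := (h i).smul c

/-- `H²(ℝⁿ)` as a normed space. -/
abbrev H2 (n : ℕ) : Type := H2Submodule n

/-- The inclusion of `H²` in `H¹`. -/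
def H2.toH1 {n : ℕ} (w : H2 n) : H1 n := ⟨(w.1.1, fun i => (w.1.2 i).toL2), w.2⟩

/-- The inclusion of `H²` in `L²`. -/
def H2.toL2 {n : ℕ} (w : H2 n) : L2 n := w.toH1.toL2

/-- The weak gradient of an element of `H²`. -/
def H2.grad {n : ℕ} (w : H2 n) (i : Fin n) : L2 n := w.toH1.grad i

/-- The weak Laplacian `∑ᵢ ∂ᵢ∂ᵢ w` of an element of `H²`. -/
def H2.laplacian {n : ℕ} (w : H2 n) : L2 n := ∑ i, (w.1.2 i).grad i

/-- `f ≥ 0` almost everywhere. -/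
def Nonneg {n : ℕ} (f : L2 n) : Prop := ∀ᵐ x, 0 ≤ f x

/-- The (essential) support of `f` lies in the ball of radius `r` around the origin. -/
def SupportedInBall {n : ℕ} (r : ℝ) (f : L2 n) : Prop := ∀ᵐ x, r < ‖x‖ → f x = 0

/-- `p` is the Strauss exponent: the positive root of `(n-1) p² - (n+1) p - 2 = 0`. -/
def IsStraussExponent (n : ℕ) (p : ℝ) : Prop :=
  0 < p ∧ ((n : ℝ) - 1) * p ^ 2 - ((n : ℝ) + 1) * p - 2 = 0

/-- The time interval `[0, T)`, where `T = ∞` is allowed. -/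
def timeInterval (T : EReal) : Set ℝ := {t | 0 ≤ t ∧ (t : EReal) < T}

/-- The class `C₀^∞([0,T) × ℝⁿ)`, given by the functions in `C₀^∞((-∞,T) × ℝⁿ)`, of which only
the values at nonnegative times are used below. -/
def IsTestFunction {n : ℕ} (T : EReal) (ψ : ℝ × Space n → ℝ) : Prop :=
  ContDiff ℝ ∞ ψ ∧ HasCompactSupport ψ ∧ ∀ z ∈ tsupport ψ, (z.1 : EReal) < T

/-- `∂ψ/∂s (s, x)`. -/
def timeDeriv {n : ℕ} (ψ : ℝ × Space n → ℝ) (s : ℝ) (x : Space n) : ℝ :=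
  deriv (fun σ => ψ (σ, x)) s

/-- `∂ψ/∂xᵢ (s, x)`. -/
def spaceDeriv {n : ℕ} (ψ : ℝ × Space n → ℝ) (i : Fin n) (s : ℝ) (x : Space n) : ℝ :=
  pderiv i (fun y => ψ (s, y)) x

/-- The time derivative `u_t(t) ∈ L²(ℝⁿ)` of `u : [0,T) → H²(ℝⁿ)`, one-sided at `t = 0`. -/
def ut {n : ℕ} (T : EReal) (u : ℝ → H2 n) (t : ℝ) : L2 n :=
  derivWithin (fun s => (u s).toL2) (timeInterval T) t

/-- `u ∈ L^p_loc([0,T) × ℝⁿ)`: the `p`-th power is integrable on every `[0,t] × B_ρ`, `t < T`. -/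
def InLpLoc {n : ℕ} (p : ℝ) (T : EReal) (u : ℝ → H2 n) : Prop :=
  ∀ t ∈ timeInterval T, ∀ ρ : ℝ,
    ∫⁻ s in Icc 0 t, ∫⁻ x in Metric.closedBall (0 : Space n) ρ, ‖(u s).toL2 x‖ₑ ^ p < ⊤

/-- Energy solutions on `[0,T)` of the Cauchy problem
`β u_ttt + u_tt - Δu - β Δu_t = |u|^p`, `(u, u_t, u_tt)(0) = ε (u₀, u₁, u₂)`,
in the sense of the wave equation with memory
`u_tt - Δu = ε e^{-t/β} (u₂ - Δu₀) + β⁻¹ ∫₀ᵗ e^{-(t-s)/β} |u(s)|^p ds`.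
Values of `u` outside of `[0,T)` play no role. -/
structure IsEnergySolution {n : ℕ} (β p ε : ℝ) (u₀ : H2 n) (u₁ : H1 n) (u₂ : L2 n)
    (T : EReal) (u : ℝ → H2 n) : Prop where
  continuousOn_H2 : ContinuousOn u (timeInterval T)
  contDiffOn_H1 : ContDiffOn ℝ 1 (fun t => (u t).toH1) (timeInterval T)
  contDiffOn_L2 : ContDiffOn ℝ 2 (fun t => (u t).toL2) (timeInterval T)
  inLpLoc : InLpLoc p T u
  initial : u 0 = ε • u₀
  identity : ∀ ψ : ℝ × Space n → ℝ, IsTestFunction T ψ → ∀ t ∈ timeInterval T,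
    (∫ x, ut T u t x * ψ (t, x)) - ε * (∫ x, u₁.toL2 x * ψ (0, x))
      + (∫ s in (0 : ℝ)..t, ∫ x,
          ((∑ i, (u s).grad i x * spaceDeriv ψ i s x) - ut T u s x * timeDeriv ψ s x))
    = ε * (∫ s in (0 : ℝ)..t, Real.exp (-s / β) *
          ∫ x, ψ (s, x) * (u₂ x - u₀.laplacian x))
      + 1 / β * (∫ s in (0 : ℝ)..t, ∫ τ in (0 : ℝ)..s, Real.exp ((τ - s) / β) *
          ∫ x, ψ (s, x) * |(u τ).toL2 x| ^ p)

end MGT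

end

/-! The proof is the test-function method for the critical wave equation, carried through the memory
term. The kernel `β⁻¹ e^{-(s-τ)/β}` is undone by its adjoint: testing with `a = c - β c'` turns the
nonlinear term into the integral of `c |u|^p` without any memory (`integral_memory_eq`). Take `c` to
be the time factor of a plane wave `e^{-l(s+R+1) + l⟨θ,x⟩}` times a cut-off `η(s/M)`. The plane wave
solves the wave equation, so only terms with derivatives of `η` survive on the linear side, and the
contributions of `u₁` and of `u₂ - Δu₀` are nonnegative and can be dropped. This gives
`IsEnergySolution.lintegral_planeWave_le`, one inequality for each direction `θ` and frequency `l >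
0`.

Integrating these inequalities against `l^(q-1) dl dθ` replaces plane waves by `V_q = waveAvg q`,
the directional average of `(s+R+1-⟨θ,x⟩)^(-q)`. With `w = -η'` the result
(`exists_lintegral_waveAvg_le`) reads `ε + ∫ η(s/M) |u|^p V_q ≲ M⁻¹ ∫ w(s/M)^(1/p) |u| V_{q+1}`. Let
`q₁ = (n-1)/2 - 1/p` and `H = ∫ w(s/M) |u|^p V_{q₁}`. Hölder's inequality, the pointwise bounds for
`V_q` and the Strauss equation, which makes all powers of `M` cancel, bound the right side by
`H^(1/p)` times `(log M)^(1/p')` if `q = q₁`, and times a constant if `q = q₁ + 1/p'`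
(`exists_lintegral_mul_waveAvg_le`).

Now put `M = e^τ` and `Z(τ) = ∫ η(s/e^τ) |u|^p V_{q₁}`. Since `w` lives on `[1/2, 1]`, `Z' ≥ H/2`.
The second choice of `q` yields `Z' ≳ ε^p`, the first one `Z' ≳ τ^(1-p) Z^p`. By
`exists_le_of_deriv_ge_rpow` such a `Z` reaches at most `τ ≲ ε^(-p(p-1))`, which is the bound for
`log T`. -/

noncomputable section

namespace MGT

/-! ### Differential inequality, cut-off profile, measurable representatives -/

section

open Filter Topology

/-- A nonnegative function with `Z' ≥ a δ` and `Z' ≥ a τ ^ (1 - p) Z ^ p` on `[τ₀, τ₁]` can only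
exist if `τ₁` is at most of order `δ ^ (1 - p)`. -/
lemma exists_le_of_deriv_ge_rpow {p a τ₀ : ℝ} (hp : 1 < p) (ha : 0 < a) (hτ₀ : 0 < τ₀) :
    ∃ C : ℝ, 0 < C ∧ ∀ (δ τ₁ : ℝ) (Z Z' : ℝ → ℝ), 0 < δ →
      (∀ τ ∈ Icc τ₀ τ₁, HasDerivAt Z (Z' τ) τ) → (∀ τ ∈ Icc τ₀ τ₁, 0 ≤ Z τ) →
      (∀ τ ∈ Icc τ₀ τ₁, a * δ ≤ Z' τ) →
      (∀ τ ∈ Icc τ₀ τ₁, a * τ ^ (1 - p) * Z τ ^ p ≤ Z' τ) →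
      τ₁ ≤ max (4 * τ₀) (C * δ ^ (1 - p)) := by
  refine ⟨(a / 4) ^ (1 - p) * (2 / ((p - 1) * a)), by have := sub_pos.2 hp; positivity, ?_⟩
  intro δ τ₁ Z Z' hδ hd hZ h1 h2
  rcases le_total τ₁ (4 * τ₀) with h | h
  · exact h.trans (le_max_left _ _)
  refine le_trans ?_ (le_max_right _ _)
  have hp' := sub_pos.2 hp
  have hτ₁ : 0 < τ₁ := by linarith
  have hσ0 : τ₀ ≤ τ₁ / 2 := by linarith
  have hmono : MonotoneOn (fun τ => Z τ - a * δ * τ) (Icc τ₀ τ₁) := by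
    have hder : ∀ τ ∈ Icc τ₀ τ₁, HasDerivAt (fun τ => Z τ - a * δ * τ) (Z' τ - a * δ) τ := by
      intro τ hτ
      simpa using (hd τ hτ).fun_sub ((hasDerivAt_id τ).const_mul (a * δ))
    refine monotoneOn_of_deriv_nonneg (convex_Icc _ _)
      (fun τ hτ => (hder τ hτ).continuousAt.continuousWithinAt) ?_ ?_
    · intro τ hτ
      exact (hder τ (interior_subset hτ)).differentiableAt.differentiableWithinAt
    · intro τ hτ
      rw [(hder τ (interior_subset hτ)).deriv]
      linarith [h1 τ (interior_subset hτ)]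
  -- The linear lower bound on `Z'` alone makes `Z` of size `δ τ₁` on the second half of the
  -- interval. There `Z` is positive, so that `Z^(1-p)` can be differentiated.
  have hZlow : ∀ τ ∈ Icc (τ₁ / 2) τ₁, a * δ * τ₁ / 4 ≤ Z τ := by
    intro τ hτ
    have hmem : τ ∈ Icc τ₀ τ₁ := ⟨hσ0.trans hτ.1, hτ.2⟩
    have h0 : τ₀ ∈ Icc τ₀ τ₁ := ⟨le_rfl, by linarith⟩
    have := hmono h0 hmem hmem.1
    have hz := hZ τ₀ h0
    have h3 : τ₁ / 4 ≤ τ - τ₀ := by linarith [hτ.1]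
    have h4 := mul_le_mul_of_nonneg_left h3 (mul_pos ha hδ).le
    simp only at this
    linarith
  have hpos : 0 < a * δ * τ₁ / 4 := by positivity
  -- Separation of variables: `(Z^(1-p))' = -(p-1) Z' Z^(-p) ≤ -(p-1) a τ₁^(1-p)`.
  have hanti : AntitoneOn (fun τ => Z τ ^ (1 - p) + (p - 1) * a * τ₁ ^ (1 - p) * τ)
      (Icc (τ₁ / 2) τ₁) := by
    have hder : ∀ τ ∈ Icc (τ₁ / 2) τ₁,
        HasDerivAt (fun τ => Z τ ^ (1 - p) + (p - 1) * a * τ₁ ^ (1 - p) * τ)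
          (Z' τ * (1 - p) * Z τ ^ (1 - p - 1) + (p - 1) * a * τ₁ ^ (1 - p)) τ := by
      intro τ hτ
      have hz : 0 < Z τ := hpos.trans_le (hZlow τ hτ)
      have e1 := (hd τ ⟨hσ0.trans hτ.1, hτ.2⟩).rpow_const (p := 1 - p) (Or.inl hz.ne')
      simpa using e1.fun_add ((hasDerivAt_id τ).const_mul ((p - 1) * a * τ₁ ^ (1 - p)))
    refine antitoneOn_of_deriv_nonpos (convex_Icc _ _)
      (fun τ hτ => (hder τ hτ).continuousAt.continuousWithinAt) ?_ ?_
    · intro τ hτ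
      exact (hder τ (interior_subset hτ)).differentiableAt.differentiableWithinAt
    · intro τ hτ
      have hτ' := interior_subset hτ
      rw [(hder τ hτ').deriv]
      have hz : 0 < Z τ := hpos.trans_le (hZlow τ hτ')
      have e2 := h2 τ ⟨hσ0.trans hτ'.1, hτ'.2⟩
      have e3 : τ₁ ^ (1 - p) ≤ τ ^ (1 - p) :=
        Real.rpow_le_rpow_of_nonpos (by linarith [hτ'.1]) hτ'.2 (by linarith)
      have e4 : Z τ ^ (1 - p - 1) * Z τ ^ p = 1 := by
        rw [← Real.rpow_add hz]; ring_nf; simp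
      have e5 : a * τ ^ (1 - p) ≤ Z' τ * Z τ ^ (1 - p - 1) := by
        calc a * τ ^ (1 - p) = a * τ ^ (1 - p) * Z τ ^ p * Z τ ^ (1 - p - 1) := by
              rw [mul_assoc _ (Z τ ^ p), mul_comm (Z τ ^ p), e4, mul_one]
          _ ≤ _ := by gcongr
      have e6 : a * τ₁ ^ (1 - p) ≤ a * τ ^ (1 - p) := by gcongr
      nlinarith
  have hend : τ₁ ∈ Icc (τ₁ / 2) τ₁ := ⟨by linarith, le_rfl⟩
  have hst : τ₁ / 2 ∈ Icc (τ₁ / 2) τ₁ := ⟨le_rfl, by linarith⟩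
  have hA := hanti hst hend (by linarith)
  simp only at hA
  have hZ1 : 0 ≤ Z τ₁ ^ (1 - p) := Real.rpow_nonneg (hpos.le.trans (hZlow _ hend)) _
  have hB : Z (τ₁ / 2) ^ (1 - p) ≤ (a * δ * τ₁ / 4) ^ (1 - p) :=
    Real.rpow_le_rpow_of_nonpos hpos (hZlow _ hst) (by linarith)
  -- Both sides of the integrated inequality carry the factor `τ₁^(1-p)`. It cancels, and what
  -- remains is linear in `τ₁`.
  have hC : (a * δ * τ₁ / 4) ^ (1 - p) = (a / 4) ^ (1 - p) * δ ^ (1 - p) * τ₁ ^ (1 - p) := by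
    rw [← Real.mul_rpow (by positivity) (by positivity),
      ← Real.mul_rpow (by positivity) (by positivity)]
    ring_nf
  have hD : 0 < τ₁ ^ (1 - p) := Real.rpow_pos_of_pos hτ₁ _
  have hE : (p - 1) * a * (τ₁ / 2) ≤ (a / 4) ^ (1 - p) * δ ^ (1 - p) := by
    refine le_of_mul_le_mul_right ?_ hD
    linarith
  have : τ₁ = (p - 1) * a * (τ₁ / 2) * (2 / ((p - 1) * a)) := by field_simp
  rw [this]
  calc _ ≤ (a / 4) ^ (1 - p) * δ ^ (1 - p) * (2 / ((p - 1) * a)) := by gcongr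
    _ = _ := by ring

/-- A cut-off profile: `η` equals a positive constant up to time `1/2`, vanishes after time `1`, and
the derivatives up to order three are controlled by the power `1/p` of `w = -η'`. -/
structure IsCutoff (p C : ℝ) (η w w' w'' : ℝ → ℝ) : Prop where
  contDiff : ContDiff ℝ ∞ η
  contDiff_w : ContDiff ℝ ∞ w
  pos_const : 0 < C
  hasDerivAt : ∀ s, HasDerivAt η (-w s) s
  hasDerivAt_w : ∀ s, HasDerivAt w (w' s) s
  hasDerivAt_w' : ∀ s, HasDerivAt w' (w'' s) s
  w_nonneg : ∀ s, 0 ≤ w s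
  w_le_one : ∀ s, w s ≤ 1
  w_eq_zero_of_le : ∀ s, s ≤ 1 / 2 → w s = 0
  w_eq_zero_of_ge : ∀ s, 1 ≤ s → w s = 0
  nonneg : ∀ s, 0 ≤ s → 0 ≤ η s
  eq_zero : ∀ s, 1 ≤ s → η s = 0
  pos_zero : 0 < η 0
  w_le : ∀ s, w s ≤ C * w s ^ (1 / p)
  abs_w'_le : ∀ s, |w' s| ≤ C * w s ^ (1 / p)
  abs_w''_le : ∀ s, |w'' s| ≤ C * w s ^ (1 / p)

/-- A high power `w = χ^K` of a bump loses at most two factors of `χ` in two derivatives, and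
`χ^(K-2) ≤ w^(1/p)` as soon as `K ≥ 2p/(p-1)`. The power is built into `w = -η'` rather than into
`η`, so that Hölder's inequality later produces an integral against `w`, which is comparable to a
derivative in `log M`. -/
lemma exists_isCutoff {p : ℝ} (hp : 1 < p) :
    ∃ (η w w' w'' : ℝ → ℝ) (C : ℝ), IsCutoff p C η w w' w'' := by
  -- Centre `3/4` and outer radius `1/4`: the bump vanishes outside `(1/2, 1)`.
  let χ : ContDiffBump (3 / 4 : ℝ) := ⟨1 / 8, 1 / 4, by norm_num, by norm_num⟩
  have hχs : ContDiff ℝ ∞ χ := χ.contDiff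
  have hχ0 : ∀ s, 0 ≤ χ s := fun s => χ.nonneg
  have hχ1 : ∀ s, χ s ≤ 1 := fun s => χ.le_one
  obtain ⟨K, hK⟩ := exists_nat_ge (2 * p / (p - 1))
  have hp' := sub_pos.2 hp
  have hK2 : (2 : ℝ) ≤ K := by
    refine le_trans ?_ hK
    rw [le_div_iff₀ hp']; linarith
  have hK2' : 2 ≤ K := by exact_mod_cast hK2
  obtain ⟨k, rfl⟩ := Nat.exists_eq_add_of_le' hK2'
  have hexp : (↑(k + 2) : ℝ) * (1 / p) ≤ k := by
    rw [div_le_iff₀ hp'] at hK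
    push_cast at hK ⊢
    rw [mul_one_div, div_le_iff₀ (by linarith)]
    nlinarith
  have hd1 : ContDiff ℝ ∞ (deriv χ) := by
    have := (contDiff_infty_iff_deriv (𝕜 := ℝ) (f := χ)).1 hχs
    exact this.2
  have hd2 : ContDiff ℝ ∞ (deriv (deriv χ)) := (contDiff_infty_iff_deriv.1 hd1).2
  have hχd : ∀ s, HasDerivAt χ (deriv χ s) s := fun s =>
    ((contDiff_infty_iff_deriv.1 hχs).1 s).hasDerivAt
  have hχdd : ∀ s, HasDerivAt (deriv χ) (deriv (deriv χ) s) s := fun s =>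
    ((contDiff_infty_iff_deriv.1 hd1).1 s).hasDerivAt
  obtain ⟨A, hA⟩ := hd1.continuous.bounded_above_of_compact_support χ.hasCompactSupport.deriv
  obtain ⟨B, hB⟩ := hd2.continuous.bounded_above_of_compact_support χ.hasCompactSupport.deriv.deriv
  simp only [Real.norm_eq_abs] at hA hB
  have hA0 : 0 ≤ A := (abs_nonneg _).trans (hA 0)
  have hB0 : 0 ≤ B := (abs_nonneg _).trans (hB 0)
  let w : ℝ → ℝ := fun s => χ s ^ (k + 2)
  have hw : ContDiff ℝ ∞ w := hχs.pow _
  have hwp : ∀ s, χ s ^ k ≤ w s ^ (1 / p) := by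
    intro s
    have : w s ^ (1 / p) = χ s ^ ((↑(k + 2) : ℝ) * (1 / p)) := by
      rw [Real.rpow_mul (hχ0 s), Real.rpow_natCast]
    rw [this]
    rcases (hχ0 s).eq_or_lt with h | h
    · rw [← h]
      rcases Nat.eq_zero_or_pos k with hk | hk
      · subst hk
        exfalso
        have : (0 : ℝ) < (↑(0 + 2) : ℝ) * (1 / p) := by positivity
        simp only [CharP.cast_eq_zero] at hexp
        linarith
      · rw [zero_pow hk.ne']
        exact Real.rpow_nonneg le_rfl _
    · rw [← Real.rpow_natCast]
      exact Real.rpow_le_rpow_of_exponent_ge h (hχ1 s) hexp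
  have hz1 : ∀ s, s ≤ 1 / 2 → χ s = 0 := by
    intro s hs
    refine χ.zero_of_le_dist ?_
    rw [Real.dist_eq, abs_of_neg (by linarith)]
    change (1 / 4 : ℝ) ≤ _
    linarith
  have hz2 : ∀ s, 1 ≤ s → χ s = 0 := by
    intro s hs
    refine χ.zero_of_le_dist ?_
    rw [Real.dist_eq, abs_of_pos (by linarith)]
    change (1 / 4 : ℝ) ≤ _
    linarith
  have hηd : ∀ s, HasDerivAt (fun s => ∫ σ in s..1, w σ) (-w s) s := fun s =>
    intervalIntegral.integral_hasDerivAt_left (hw.continuous.intervalIntegrable _ _)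
      (hw.continuous.stronglyMeasurableAtFilter _ _) hw.continuous.continuousAt
  have hη1 : ∀ s, 1 ≤ s → ∫ σ in s..1, w σ = 0 := by
    intro s hs
    rw [intervalIntegral.integral_symm, neg_eq_zero]
    refine intervalIntegral.integral_zero_ae (Filter.Eventually.of_forall fun x hx => ?_)
    rw [uIoc_of_le hs] at hx
    simp [w, hz2 x hx.1.le]
  refine ⟨fun s => ∫ σ in s..1, w σ, w, fun s => (k + 2 : ℕ) * χ s ^ (k + 1) * deriv χ s,
    fun s => (k + 2 : ℕ) * (((k + 1 : ℕ) * χ s ^ k * deriv χ s) * deriv χ s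
      + χ s ^ (k + 1) * deriv (deriv χ) s),
    1 + (k + 2) * A + (k + 2) * ((k + 1) * A * A + B), ?_, hw, by positivity, hηd, ?_, ?_,
    fun s => pow_nonneg (hχ0 s) _, fun s => pow_le_one₀ (hχ0 s) (hχ1 s),
    fun s hs => by simp [w, hz1 s hs], fun s hs => by simp [w, hz2 s hs], ?_, hη1, ?_, ?_, ?_, ?_⟩
  · rw [contDiff_infty_iff_deriv]
    refine ⟨fun s => (hηd s).differentiableAt, ?_⟩
    have : deriv (fun s => ∫ σ in s..1, w σ) = fun s => -w s := funext fun s => (hηd s).deriv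
    rw [this]; exact hw.neg
  · intro s
    simpa using (hχd s).fun_pow (k + 2)
  · intro s
    simpa [mul_assoc] using (((hχd s).fun_pow (k + 1)).fun_mul (hχdd s)).const_mul ((k + 2 : ℕ) : ℝ)
  · intro s hs
    rcases le_total s 1 with h | h
    · exact intervalIntegral.integral_nonneg h fun x _ => pow_nonneg (hχ0 x) _
    · exact (hη1 s h).ge
  · refine intervalIntegral.integral_pos (by norm_num) hw.continuous.continuousOn
      (fun x _ => pow_nonneg (hχ0 x) _) ⟨3 / 4, by norm_num, ?_⟩
    refine pow_pos (χ.pos_of_mem_ball ?_) _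
    simp [χ]
  all_goals intro s
  all_goals have hX := hχ0 s
  all_goals have hX1 := hχ1 s
  all_goals have hXk : 0 ≤ χ s ^ k := pow_nonneg hX k
  all_goals have hXk1 : χ s ^ (k + 1) ≤ χ s ^ k := pow_le_pow_of_le_one hX hX1 (by omega)
  all_goals have hXk10 : 0 ≤ χ s ^ (k + 1) := pow_nonneg hX _
  all_goals have hXk2 : χ s ^ (k + 2) ≤ χ s ^ k := pow_le_pow_of_le_one hX hX1 (by omega)
  all_goals refine le_trans ?_ (mul_le_mul_of_nonneg_left (hwp s) (by positivity))
  · have : 0 ≤ ((k + 2) * A + (k + 2) * ((k + 1) * A * A + B)) * χ s ^ k := by positivity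
    change χ s ^ (k + 2) ≤ _
    linarith
  · have h1 : |((k + 2 : ℕ) : ℝ) * χ s ^ (k + 1) * deriv χ s| ≤ (k + 2) * χ s ^ k * A := by
      rw [abs_mul, abs_of_nonneg (by positivity)]
      push_cast
      have := hA s
      gcongr
    have : 0 ≤ (1 + (k + 2) * ((k + 1) * A * A + B)) * χ s ^ k := by positivity
    linarith
  · have e1 := hA s
    have e2 := hB s
    have h1 : |((k + 2 : ℕ) : ℝ) * (((k + 1 : ℕ) * χ s ^ k * deriv χ s) * deriv χ s
        + χ s ^ (k + 1) * deriv (deriv χ) s)|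
        ≤ (k + 2) * ((k + 1) * χ s ^ k * A * A + χ s ^ k * B) := by
      rw [abs_mul, abs_of_nonneg (by positivity)]
      push_cast
      gcongr
      refine (abs_add_le _ _).trans ?_
      rw [abs_mul (_ * _) (deriv χ s), abs_mul _ (deriv χ s), abs_mul _ (deriv (deriv χ) s),
        abs_of_nonneg (by positivity : 0 ≤ ((k : ℝ) + 1) * χ s ^ k), abs_of_nonneg hXk10]
      gcongr
    have : 0 ≤ (1 + (k + 2) * A) * χ s ^ k := by positivity
    linarith

/-- A continuous curve in `L^q` has a jointly measurable representative. -/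
lemma exists_measurable_uncurry_ae_eq {X : Type*} [MeasurableSpace X] {μ : Measure X}
    {q : ℝ≥0∞} [hq : Fact (1 ≤ q)] {M : ℝ} (hM : 0 ≤ M)
    {F : ℝ → Lp ℝ q μ} (hF : ContinuousOn F (Icc 0 M)) :
    ∃ U : ℝ × X → ℝ, Measurable U ∧ ∀ s ∈ Icc 0 M, (fun x => U (s, x)) =ᵐ[μ] F s := by
  -- Extension of `F` by its endpoint values, uniformly continuous on the whole line; the grid
  -- points below may then leave `[0, M]`.
  obtain ⟨G, hGF, huc⟩ : ∃ G : ℝ → Lp ℝ q μ, (∀ s ∈ Icc 0 M, G s = F s) ∧ UniformContinuous G :=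
    ⟨IccExtend hM (fun s : Icc (0:ℝ) M => F s), fun s hs => IccExtend_of_mem hM _ hs,
      (CompactSpace.uniformContinuous_of_continuous hF.domRestrict).comp
        (LipschitzWith.projIcc hM).uniformContinuous⟩
  have hmod : ∀ k : ℕ, ∃ d > 0, ∀ s t, dist s t < d → dist (G s) (G t) < (1 / 4) ^ (k + 1) :=
    fun k => Metric.uniformContinuous_iff.1 huc _ (by positivity)
  choose d hd hdG using hmod
  -- Rounding down to a grid makes `G ∘ r k` take countably many values, hence jointly measurable.
  -- The mesh is chosen so that the `L^q` errors are summable, which forces convergence almost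
  -- everywhere for each fixed time.
  let r : ℕ → ℝ → ℝ := fun k s => (d k / 2) * ⌊s / (d k / 2)⌋
  have hr : ∀ k s, dist s (r k s) < d k := by
    intro k s
    have h2 : 0 < d k / 2 := half_pos (hd k)
    have e1 := Int.floor_le (s / (d k / 2))
    have e2 := Int.lt_floor_add_one (s / (d k / 2))
    rw [le_div_iff₀ h2] at e1
    rw [div_lt_iff₀ h2] at e2
    rw [Real.dist_eq, abs_of_nonneg (by simp only [r]; linarith)]
    simp only [r]; linarith
  have hrG : ∀ k s, dist (G s) (G (r k s)) < (1 / 4) ^ (k + 1) := fun k s => hdG k _ _ (hr k s)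
  let f : ℕ → ℝ × X → ℝ := fun k z => G (r k z.1) z.2
  have hfm : ∀ k, Measurable (f k) := by
    intro k
    have h1 : ∀ g : ℤ → Lp ℝ q μ, Measurable (fun y : ℤ × X => g y.1 y.2) := fun g =>
      measurable_from_prod_countable_right fun j => (Lp.stronglyMeasurable (g j)).measurable
    have h2 : Measurable (fun z : ℝ × X => (⌊z.1 / (d k / 2)⌋, z.2)) := by fun_prop
    exact (h1 fun j => G ((d k / 2) * j)).comp h2
  refine ⟨fun z => limUnder Filter.atTop (fun k => f k z),
    (StronglyMeasurable.limUnder fun k => (hfm k).stronglyMeasurable).measurable, ?_⟩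
  intro s hs
  rw [← hGF s hs]
  have hdist : ∀ k, eLpNorm ((G (r k s) : X → ℝ) - (G s : X → ℝ)) q μ <
      ENNReal.ofReal ((1 / 4) ^ (k + 1)) := by
    intro k
    have h := hrG k s
    rw [dist_comm, dist_eq_norm, Lp.norm_def] at h
    have h' := (ENNReal.lt_ofReal_iff_toReal_lt (Lp.eLpNorm_ne_top _)).2 h
    rwa [eLpNorm_congr_ae (Lp.coeFn_sub _ _)] at h'
  have hgeo : ∑' k : ℕ, ENNReal.ofReal (2 * (1 / 4) ^ (k + 1)) ≠ ⊤ := by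
    refine Summable.tsum_ofReal_ne_top ?_
    refine Summable.mul_left _ ?_
    exact (summable_nat_add_iff 1).2 (summable_geometric_of_lt_one (by norm_num) (by norm_num))
  have hcau : ∀ N n m : ℕ, N ≤ n → N ≤ m →
      eLpNorm ((G (r n s) : X → ℝ) - (G (r m s) : X → ℝ)) q μ <
        ENNReal.ofReal (2 * (1 / 4) ^ (N + 1)) := by
    intro N n m hn hm
    have hb : ∀ j, N ≤ j → dist (G (r j s)) (G s) < (1 / 4) ^ (N + 1) := fun j hj => by
      rw [dist_comm]
      exact (hrG j s).trans_le (pow_le_pow_of_le_one (by norm_num) (by norm_num) (by omega))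
    have h : dist (G (r n s)) (G (r m s)) < 2 * (1 / 4) ^ (N + 1) := by
      have := dist_triangle_right (G (r n s)) (G (r m s)) (G s)
      linarith [hb n hn, hb m hm]
    rw [dist_eq_norm, Lp.norm_def] at h
    have h' := (ENNReal.lt_ofReal_iff_toReal_lt (Lp.eLpNorm_ne_top _)).2 h
    rwa [eLpNorm_congr_ae (Lp.coeFn_sub _ _)] at h'
  have hconv := Lp.ae_tendsto_of_cauchy_eLpNorm (μ := μ) (p := q) (f := fun k x => G (r k s) x)
    (fun k => (Lp.stronglyMeasurable _).aestronglyMeasurable) hq.out hgeo hcau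
  -- The almost everywhere limit still has to be identified. Convergence in `L^q` gives a
  -- subsequence tending to `G s`, and limits are unique.
  have hmeas : TendstoInMeasure μ (fun k x => G (r k s) x) Filter.atTop (G s) := by
    refine tendstoInMeasure_of_tendsto_eLpNorm (p := q) (by have := hq.out; positivity)
      (fun k => (Lp.stronglyMeasurable _).aestronglyMeasurable)
      (Lp.stronglyMeasurable _).aestronglyMeasurable ?_
    refine tendsto_of_tendsto_of_tendsto_of_le_of_le tendsto_const_nhds ?_ (fun _ => zero_le)
      (fun k => (hdist k).le)
    rw [← ENNReal.ofReal_zero]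
    refine ENNReal.tendsto_ofReal ?_
    exact (tendsto_pow_atTop_nhds_zero_of_lt_one (by norm_num) (by norm_num)).comp
      (Filter.tendsto_add_atTop_nat 1)
  obtain ⟨ns, hns, hsub⟩ := hmeas.exists_seq_tendsto_ae
  filter_upwards [hconv, hsub] with x ⟨l, hl⟩ hx
  rw [hl.limUnder_eq]
  exact tendsto_nhds_unique (hl.comp hns.tendsto_atTop) hx

end

/-! ### The weak identity for test functions in separated variables -/

section

/-- Integration against a continuous compactly supported function, as a functional on `L²`. -/
lemma exists_clm_eq_integral_mul {n : ℕ} {b : Space n → ℝ} (hb : Continuous b)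
    (hc : HasCompactSupport b) :
    ∃ ℓ : L2 n →L[ℝ] ℝ, ∀ f : L2 n, ℓ f = ∫ x, f x * b x := by
  have hm : MemLp b 2 (volume : Measure (Space n)) := hb.memLp_of_hasCompactSupport hc
  refine ⟨innerSL ℝ hm.toLp, fun f => ?_⟩
  rw [innerSL_apply_apply, L2.inner_def]
  refine integral_congr_ae ?_
  filter_upwards [hm.coeFn_toLp] with x hx
  rw [hx]
  simp

lemma convex_timeInterval (T : EReal) : Convex ℝ (timeInterval T) := by
  have : OrdConnected (timeInterval T) := ⟨fun x hx y hy z hz =>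
    ⟨hx.1.trans hz.1, lt_of_le_of_lt (EReal.coe_le_coe_iff.2 hz.2) hy.2⟩⟩
  exact this.convex

lemma Icc_subset_timeInterval {T : EReal} {M : ℝ} (hM : (M : EReal) < T) :
    Icc 0 M ⊆ timeInterval T :=
  fun _ hs => ⟨hs.1, lt_of_le_of_lt (EReal.coe_le_coe_iff.2 hs.2) hM⟩

lemma timeInterval_mem_nhds {T : EReal} {M s : ℝ} (hM : (M : EReal) < T) (hs : s ∈ Ioo 0 M) :
    timeInterval T ∈ nhds s :=
  Filter.mem_of_superset (Icc_mem_nhds hs.1 hs.2) (Icc_subset_timeInterval hM)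

lemma uniqueDiffOn_timeInterval {T : EReal} {M : ℝ} (hM0 : 0 < M) (hM : (M : EReal) < T) :
    UniqueDiffOn ℝ (timeInterval T) :=
  uniqueDiffOn_convex (convex_timeInterval T) ⟨M / 2, mem_interior_iff_mem_nhds.2
    (timeInterval_mem_nhds hM ⟨by linarith, by linarith⟩)⟩

/-- The classical Laplacian. -/
def classicalLaplacian {n : ℕ} (b : Space n → ℝ) (x : Space n) : ℝ :=
  ∑ i, pderiv i (pderiv i b) x

lemma contDiff_pderiv {n : ℕ} (i : Fin n) {φ : Space n → ℝ} (h : ContDiff ℝ ∞ φ) :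
    ContDiff ℝ ∞ (pderiv i φ) :=
  (h.fderiv_right (m := ∞) (by simp)).clm_apply contDiff_const

lemma H2.sum_integral_grad_mul_pderiv {n : ℕ} (w : H2 n) {b : Space n → ℝ} (hb : ContDiff ℝ ∞ b)
    (hc : HasCompactSupport b) :
    ∑ i, ∫ x, w.grad i x * pderiv i b x = -∫ x, w.toL2 x * classicalLaplacian b x := by
  have h1 : ∀ i, ∫ x, w.grad i x * pderiv i b x = -∫ x, w.toL2 x * pderiv i (pderiv i b) x := by
    intro i
    have := w.toH1.2 i (pderiv i b) (contDiff_pderiv i hb) (hasCompactSupport_pderiv i hc)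
    rw [eq_neg_iff_add_eq_zero, add_comm, ← eq_neg_iff_add_eq_zero]
    exact this
  simp only [h1, Finset.sum_neg_distrib, classicalLaplacian, Finset.mul_sum]
  rw [integral_finsetSum]
  intro i _
  exact integrable_mul_of_hasCompactSupport _ (continuous_pderiv i (contDiff_pderiv i hb))
    (hasCompactSupport_pderiv i (hasCompactSupport_pderiv i hc))

lemma continuous_classicalLaplacian {n : ℕ} {b : Space n → ℝ} (hb : ContDiff ℝ ∞ b) :
    Continuous (classicalLaplacian b) := by
  unfold classicalLaplacian
  exact continuous_finsetSum _ fun i _ => continuous_pderiv i (contDiff_pderiv i hb)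

lemma hasCompactSupport_classicalLaplacian {n : ℕ} {b : Space n → ℝ} (hc : HasCompactSupport b) :
    HasCompactSupport (classicalLaplacian b) := by
  refine HasCompactSupport.intro hc fun x hx => ?_
  refine Finset.sum_eq_zero fun i _ => image_eq_zero_of_notMem_tsupport fun h => hx ?_
  exact (tsupport_fderiv_apply_subset ℝ _).trans (tsupport_fderiv_apply_subset ℝ _) h

variable {n : ℕ} {β p ε : ℝ} {u₀ : H2 n} {u₁ : H1 n} {u₂ : L2 n} {T : EReal} {u : ℝ → H2 n}

/-- The defining identity for a test function `a(s) b(x)` in separated variables, where `a` vanishes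
from time `M` on. -/
lemma IsEnergySolution.identity_mul (h : IsEnergySolution β p ε u₀ u₁ u₂ T u) {M : ℝ} (hM0 : 0 < M)
    (hM : (M : EReal) < T) {a a' : ℝ → ℝ} (ha : ContDiff ℝ ∞ a) (ha' : ∀ s, HasDerivAt a (a' s) s)
    (haM : ∀ s, M ≤ s → a s = 0) {b : Space n → ℝ} (hb : ContDiff ℝ ∞ b)
    (hc : HasCompactSupport b) :
    (∫ s in (0 : ℝ)..M, (-(a s * ∫ x, (u s).toL2 x * classicalLaplacian b x)
        - a' s * ∫ x, ut T u s x * b x))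
    = ε * (a 0 * ∫ x, u₁.toL2 x * b x)
      + ε * (∫ s in (0 : ℝ)..M, Real.exp (-s / β) * (a s * ∫ x, b x * (u₂ x - u₀.laplacian x)))
      + 1 / β * (∫ s in (0 : ℝ)..M, ∫ τ in (0 : ℝ)..s, Real.exp ((τ - s) / β) *
          (a s * ∫ x, b x * |(u τ).toL2 x| ^ p)) := by
  -- `a` vanishes only for late times; `ρ` also cuts off negative times to make the support compact,
  -- and equals `1` on `[0, M]`.
  let ρ : ContDiffBump (0 : ℝ) := ⟨M + 1, M + 2, by linarith, by linarith⟩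
  have hρ1 : ∀ s, |s| < M + 1 → ρ s = 1 := fun s hs => by
    refine ρ.one_of_mem_closedBall ?_
    rw [Metric.mem_closedBall, Real.dist_eq, sub_zero]
    exact hs.le
  have hρ0 : ∀ s, M + 2 ≤ |s| → ρ s = 0 := fun s hs => by
    refine ρ.zero_of_le_dist ?_
    rw [Real.dist_eq, sub_zero]
    exact hs
  let ψ : ℝ × Space n → ℝ := fun z => ρ z.1 * a z.1 * b z.2
  have hψs : ContDiff ℝ ∞ ψ :=
    ((ρ.contDiff.comp contDiff_fst).mul (ha.comp contDiff_fst)).mul (hb.comp contDiff_snd)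
  have hψ : IsTestFunction T ψ := by
    refine ⟨hψs, ?_, ?_⟩
    · refine HasCompactSupport.intro ((isCompact_closedBall (0 : ℝ) (M + 2)).prod hc) ?_
      intro z hz
      rw [mem_prod, not_and_or] at hz
      rcases hz with hz | hz
      · rw [Metric.mem_closedBall, Real.dist_eq, sub_zero, not_le] at hz
        simp [ψ, hρ0 _ hz.le]
      · simp [ψ, image_eq_zero_of_notMem_tsupport hz]
    · intro z hz
      have : tsupport ψ ⊆ {z | z.1 ≤ M} := by
        refine closure_minimal ?_ (isClosed_le continuous_fst continuous_const)
        intro z hz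
        by_contra hlt
        exact hz (by simp [ψ, haM z.1 (not_le.1 hlt).le])
      exact lt_of_le_of_lt (EReal.coe_le_coe_iff.2 (this hz)) hM
  -- At `t = M` the boundary term with `u_t(t)` drops out because `a M = 0`.
  have hid := h.identity ψ hψ M ⟨hM0.le, hM⟩
  have hval : ∀ s ∈ Icc 0 M, ∀ x, ψ (s, x) = a s * b x := by
    intro s hs x
    simp [ψ, hρ1 s (by rw [abs_of_nonneg hs.1]; linarith [hs.2])]
  have htime : ∀ s ∈ Icc 0 M, ∀ x, timeDeriv ψ s x = a' s * b x := by
    intro s hs x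
    have hev : (fun σ => ψ (σ, x)) =ᶠ[nhds s] fun σ => a σ * b x := by
      have : ∀ᶠ σ in nhds s, |σ| < M + 1 :=
        continuous_abs.continuousAt.eventually_lt continuousAt_const
          (by rw [abs_of_nonneg hs.1]; linarith [hs.2])
      filter_upwards [this] with σ hσ
      simp [ψ, hρ1 σ hσ]
    rw [timeDeriv, hev.deriv_eq]
    exact ((ha' s).mul_const (b x)).deriv
  have hspace : ∀ s ∈ Icc 0 M, ∀ i x, spaceDeriv ψ i s x = a s * pderiv i b x := by
    intro s hs i x
    have : (fun y => ψ (s, y)) = fun y => a s * b y := funext fun y => hval s hs y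
    rw [spaceDeriv, this, pderiv, fderiv_const_mul (hb.differentiable (by simp) x)]
    rfl
  have hsub : ∀ s ∈ uIcc 0 M, s ∈ Icc 0 M := fun s hs => by rwa [uIcc_of_le hM0.le] at hs
  have e1 : ∫ x, ut T u M x * ψ (M, x) = 0 := by
    have : ∀ x, ψ (M, x) = 0 := fun x => by
      rw [hval M ⟨hM0.le, le_rfl⟩, haM M le_rfl, zero_mul]
    simp [this]
  have e2 : ∫ x, u₁.toL2 x * ψ (0, x) = a 0 * ∫ x, u₁.toL2 x * b x := by
    rw [← integral_const_mul]
    congr 1; ext x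
    rw [hval 0 ⟨le_rfl, hM0.le⟩]; ring
  have e3 : ∀ s ∈ uIcc 0 M, (∫ x,
      ((∑ i, (u s).grad i x * spaceDeriv ψ i s x) - ut T u s x * timeDeriv ψ s x))
      = -(a s * ∫ x, (u s).toL2 x * classicalLaplacian b x) - a' s * ∫ x, ut T u s x * b x := by
    intro s hs
    have hs := hsub s hs
    have hint : ∀ i ∈ Finset.univ, Integrable (fun x => a s * ((u s).grad i x * pderiv i b x)) :=
      fun i _ => (integrable_mul_of_hasCompactSupport _ (continuous_pderiv i hb)
        (hasCompactSupport_pderiv i hc)).const_mul _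
    calc _ = ∫ x, ((∑ i, a s * ((u s).grad i x * pderiv i b x)) - a' s * (ut T u s x * b x)) := by
          congr 1; ext x
          rw [htime s hs]
          congr 1
          · refine Finset.sum_congr rfl fun i _ => ?_
            rw [hspace s hs]; ring
          · ring
      _ = (∑ i, a s * ∫ x, ((u s).grad i x * pderiv i b x)) - a' s * ∫ x, ut T u s x * b x := by
          rw [integral_sub (integrable_finsetSum _ hint), integral_finsetSum _ hint,
            integral_const_mul]
          · simp only [integral_const_mul]
          · exact (integrable_mul_of_hasCompactSupport _ hb.continuous hc).const_mul _
      _ = _ := by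
          rw [← Finset.mul_sum, H2.sum_integral_grad_mul_pderiv _ hb hc, mul_neg]
  have e4 : ∀ s ∈ uIcc 0 M, Real.exp (-s / β) * (∫ x, ψ (s, x) * (u₂ x - u₀.laplacian x))
      = Real.exp (-s / β) * (a s * ∫ x, b x * (u₂ x - u₀.laplacian x)) := by
    intro s hs
    simp only [hval s (hsub s hs), mul_assoc, integral_const_mul]
  have e5 : ∀ s ∈ uIcc 0 M, (∫ τ in (0 : ℝ)..s, Real.exp ((τ - s) / β) *
          ∫ x, ψ (s, x) * |(u τ).toL2 x| ^ p)
      = ∫ τ in (0 : ℝ)..s, Real.exp ((τ - s) / β) * (a s * ∫ x, b x * |(u τ).toL2 x| ^ p) := by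
    intro s hs
    congr 1; ext τ
    simp only [hval s (hsub s hs), mul_assoc, integral_const_mul]
  rw [e1, e2, intervalIntegral.integral_congr e3, intervalIntegral.integral_congr e4,
    intervalIntegral.integral_congr e5] at hid
  linarith

/-- The identity of `IsEnergySolution.identity_mul` after an integration by parts in time. -/
lemma IsEnergySolution.identity_mul_integrated (h : IsEnergySolution β p ε u₀ u₁ u₂ T u) {M : ℝ}
    (hM0 : 0 < M) (hM : (M : EReal) < T) {a a' a'' : ℝ → ℝ} (ha : ContDiff ℝ ∞ a)
    (ha' : ∀ s, HasDerivAt a (a' s) s) (ha'' : ∀ s, HasDerivAt a' (a'' s) s)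
    (hac : Continuous a'')
    (haM : ∀ s, M ≤ s → a s = 0) (haM' : a' M = 0) {b : Space n → ℝ} (hb : ContDiff ℝ ∞ b)
    (hc : HasCompactSupport b) :
    (∫ s in (0 : ℝ)..M, ((a'' s * ∫ x, (u s).toL2 x * b x)
        - (a s * ∫ x, (u s).toL2 x * classicalLaplacian b x)))
    = ε * (a 0 * (∫ x, u₁.toL2 x * b x) - a' 0 * ∫ x, u₀.toL2 x * b x)
      + ε * (∫ s in (0 : ℝ)..M, Real.exp (-s / β) * (a s * ∫ x, b x * (u₂ x - u₀.laplacian x)))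
      + 1 / β * (∫ s in (0 : ℝ)..M, ∫ τ in (0 : ℝ)..s, Real.exp ((τ - s) / β) *
          (a s * ∫ x, b x * |(u τ).toL2 x| ^ p)) := by
  have hid := h.identity_mul hM0 hM ha ha' haM hb hc
  obtain ⟨ℓ, hℓ⟩ := exists_clm_eq_integral_mul hb.continuous hc
  obtain ⟨ℓ', hℓ'⟩ := exists_clm_eq_integral_mul (continuous_classicalLaplacian hb)
    (hasCompactSupport_classicalLaplacian hc)
  simp only [← hℓ, ← hℓ'] at hid ⊢
  have hv : ContinuousOn (fun s => (u s).toL2) (Icc 0 M) :=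
    h.contDiffOn_L2.continuousOn.mono (Icc_subset_timeInterval hM)
  have hut : ContinuousOn (ut T u) (Icc 0 M) :=
    (h.contDiffOn_L2.continuousOn_derivWithin (uniqueDiffOn_timeInterval hM0 hM)
      (by norm_num)).mono (Icc_subset_timeInterval hM)
  have hy : ContinuousOn (fun s => ℓ (u s).toL2) (uIcc 0 M) := by
    rw [uIcc_of_le hM0.le]; exact ℓ.continuous.comp_continuousOn hv
  have hy2 : ContinuousOn (fun s => ℓ' (u s).toL2) (uIcc 0 M) := by
    rw [uIcc_of_le hM0.le]; exact ℓ'.continuous.comp_continuousOn hv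
  have hy' : ContinuousOn (fun s => ℓ (ut T u s)) (uIcc 0 M) := by
    rw [uIcc_of_le hM0.le]; exact ℓ.continuous.comp_continuousOn hut
  have ha'c : Continuous a' := continuous_iff_continuousAt.2 fun s => (ha'' s).continuousAt
  have hder : ∀ s ∈ Ioo (min 0 M) (max 0 M),
      HasDerivAt (fun s => ℓ (u s).toL2) (ℓ (ut T u s)) s := by
    intro s hs
    rw [min_eq_left hM0.le, max_eq_right hM0.le] at hs
    have hmem := timeInterval_mem_nhds hM hs
    have hd : DifferentiableWithinAt ℝ (fun s => (u s).toL2) (timeInterval T) s :=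
      (h.contDiffOn_L2.differentiableOn (by norm_num)) s (mem_of_mem_nhds hmem)
    exact ℓ.hasFDerivAt.comp_hasDerivAt s (hd.hasDerivWithinAt.hasDerivAt hmem)
  have hparts := intervalIntegral.integral_mul_deriv_eq_deriv_mul_of_hasDerivAt
    (u := a') (v := fun s => ℓ (u s).toL2) (u' := a'') (v' := fun s => ℓ (ut T u s))
    (a := 0) (b := M) ha'c.continuousOn hy (fun s _ => ha'' s) hder
    (hac.intervalIntegrable _ _) hy'.intervalIntegrable
  have hu0 : (u 0).toL2 = ε • u₀.toL2 := by rw [h.initial]; rfl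
  rw [haM', zero_mul, hu0, map_smul, smul_eq_mul] at hparts
  have hia : IntervalIntegrable (fun s => a s * ℓ' (u s).toL2) volume 0 M :=
    (ha.continuous.continuousOn.mul hy2).intervalIntegrable
  have hia' : IntervalIntegrable (fun s => a' s * ℓ (ut T u s)) volume 0 M :=
    (ha'c.continuousOn.mul hy').intervalIntegrable
  have hia'' : IntervalIntegrable (fun s => a'' s * ℓ (u s).toL2) volume 0 M :=
    (hac.continuousOn.mul hy).intervalIntegrable
  have hian : IntervalIntegrable (fun s => -(a s * ℓ' (u s).toL2)) volume 0 M := hia.neg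
  rw [intervalIntegral.integral_sub hian hia',
    intervalIntegral.integral_neg, hparts] at hid
  rw [intervalIntegral.integral_sub hia'' hia]
  linarith

end

/-! ### Inverting the memory kernel; exponentials in space -/

section

/-- The exponential memory kernel applied to `a = c - β c'` gives back `c`. -/
lemma integral_memory_eq {β M : ℝ} (hβ : 0 < β) (hM : 0 ≤ M) {a c c' : ℝ → ℝ}
    (hc : ∀ s, HasDerivAt c (c' s) s) (hac : ∀ s, a s = c s - β * c' s) (ha : Continuous a)
    (hcM : c M = 0) {N : ℝ → ℝ} (hN : IntegrableOn N (Ioc 0 M)) :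
    1 / β * (∫ s in (0 : ℝ)..M, ∫ τ in (0 : ℝ)..s, Real.exp ((τ - s) / β) * (a s * N τ))
      = ∫ τ in (0 : ℝ)..M, c τ * N τ := by
  let A : ℝ → ℝ := fun s => a s * Real.exp (-s / β)
  let B : ℝ → ℝ := fun τ => Real.exp (τ / β) * N τ
  have hA : Continuous A := by fun_prop
  have hAi : IntegrableOn A (Ioc 0 M) := (hA.integrableOn_Icc (a := 0) (b := M)).mono_set
    Ioc_subset_Icc_self
  have hBi : IntegrableOn B (Ioc 0 M) := by
    have h1 : IntervalIntegrable N volume 0 M :=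
      (intervalIntegrable_iff_integrableOn_Ioc_of_le hM).2 hN
    have h2 : Continuous fun τ : ℝ => Real.exp (τ / β) := by fun_prop
    exact (intervalIntegrable_iff_integrableOn_Ioc_of_le hM).1
      (h1.continuousOn_mul h2.continuousOn)
  have hAB : ∀ s τ, Real.exp ((τ - s) / β) * (a s * N τ) = A s * B τ := by
    intro s τ
    have : (τ - s) / β = -s / β + τ / β := by ring
    simp only [A, B]
    rw [this, Real.exp_add]; ring
  -- The integrand on the triangle `τ ≤ s`, extended by zero to the square so that Fubini applies.
  let F : ℝ → ℝ → ℝ := fun s τ => (Iic s).indicator (fun τ => A s * B τ) τ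
  have hFu : Function.uncurry F = {z : ℝ × ℝ | z.2 ≤ z.1}.indicator (fun z => A z.1 * B z.2) := by
    ext z
    simp [F, Function.uncurry, indicator_apply]
  have hF : Integrable (Function.uncurry F)
      ((volume.restrict (Ioc 0 M)).prod (volume.restrict (Ioc 0 M))) := by
    rw [hFu]
    exact (Integrable.mul_prod hAi hBi).indicator (measurableSet_le measurable_snd measurable_fst)
  have h1 : ∫ s in (0 : ℝ)..M, ∫ τ in (0 : ℝ)..s, Real.exp ((τ - s) / β) * (a s * N τ)
      = ∫ s in Ioc 0 M, ∫ τ in Ioc 0 M, F s τ := by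
    rw [intervalIntegral.integral_of_le hM]
    refine setIntegral_congr_fun measurableSet_Ioc fun s hs => ?_
    simp only [hAB]
    rw [intervalIntegral.integral_of_le hs.1.le, setIntegral_indicator measurableSet_Iic]
    congr 2
    ext τ
    simp only [mem_Ioc, mem_inter_iff, mem_Iic]
    exact ⟨fun h => ⟨⟨h.1, h.2.trans hs.2⟩, h.2⟩, fun h => ⟨h.1.1, h.2⟩⟩
  have h2 : ∀ τ ∈ Ioc 0 M, ∫ s in Ioc 0 M, F s τ = β * (c τ * N τ) := by
    intro τ hτ
    have e1 : ∀ s, F s τ = (Ici τ).indicator (fun s => A s * B τ) s := fun s => by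
      simp [F, indicator_apply]
    -- `(c - β c') e^{-s/β}` is the exact derivative of `-β c e^{-s/β}`, and the upper boundary
    -- value vanishes since `c M = 0`.
    have e2 : ∫ s in τ..M, A s = β * c τ * Real.exp (-τ / β) := by
      have hd : ∀ s ∈ uIcc τ M,
          HasDerivAt (fun s => -(β * (c s * Real.exp (-s / β)))) (A s) s := by
        intro s _
        have hexp : HasDerivAt (fun s : ℝ => Real.exp (-s / β))
            (Real.exp (-s / β) * (-1 / β)) s := by
          simpa using (((hasDerivAt_id s).fun_neg).div_const β).exp
        have := (((hc s).fun_mul hexp).const_mul β).fun_neg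
        refine this.congr_deriv ?_
        simp only [A, hac]
        field_simp
        ring
      rw [intervalIntegral.integral_eq_sub_of_hasDerivAt hd (hA.intervalIntegrable _ _), hcM]
      ring
    simp only [e1]
    rw [setIntegral_indicator measurableSet_Ici]
    have e3 : Ioc 0 M ∩ Ici τ = Icc τ M := by
      ext s
      simp only [mem_Ioc, mem_inter_iff, mem_Ici, mem_Icc]
      exact ⟨fun h => ⟨h.2, h.1.2⟩, fun h => ⟨⟨hτ.1.trans_le h.1, h.2⟩, h.1⟩⟩
    rw [e3, integral_Icc_eq_integral_Ioc, ← intervalIntegral.integral_of_le hτ.2,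
      intervalIntegral.integral_mul_const, e2]
    simp only [B]
    have : Real.exp (-τ / β) * Real.exp (τ / β) = 1 := by
      rw [← Real.exp_add]; ring_nf; simp
    linear_combination β * c τ * N τ * this
  rw [h1, integral_integral_swap hF, setIntegral_congr_fun measurableSet_Ioc h2,
    integral_const_mul, intervalIntegral.integral_of_le hM]
  field_simp

/-- A compactly supported smooth function that agrees with `x ↦ exp (l ⟪θ, x⟫)` on a given ball. -/
lemma exists_smooth_exp {n : ℕ} {l ρ : ℝ} (hρ : 0 < ρ) {θ : Space n} (hθ : ‖θ‖ = 1) :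
    ∃ b : Space n → ℝ, ContDiff ℝ ∞ b ∧ HasCompactSupport b ∧ (∀ x, 0 ≤ b x) ∧
      ∀ x, ‖x‖ ≤ ρ → b x = Real.exp (l * inner ℝ θ x) ∧
        classicalLaplacian b x = l ^ 2 * Real.exp (l * inner ℝ θ x) := by
  let χ : ContDiffBump (0 : Space n) := ⟨ρ + 1, ρ + 2, by linarith, by linarith⟩
  let e : Space n → ℝ := fun x => Real.exp (l * inner ℝ θ x)
  have he : ContDiff ℝ ∞ e :=
    (contDiff_const.mul (contDiff_const.inner ℝ contDiff_id)).exp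
  have hed : ∀ i x, pderiv i e x = l * θ i * e x := by
    intro i x
    have hin : HasFDerivAt (fun x : Space n => l * inner ℝ θ x) (l • innerSL ℝ θ) x :=
      ((innerSL ℝ θ).hasFDerivAt (x := x)).const_mul l
    rw [pderiv, hin.exp.fderiv]
    have hs : inner ℝ θ (EuclideanSpace.single i 1) = θ i := by
      simpa using EuclideanSpace.inner_single_right i (1 : ℝ) θ
    simp [e, hs]
    ring
  have hopen : IsOpen (Metric.ball (0 : Space n) (ρ + 1)) := Metric.isOpen_ball
  have hbe : ∀ x ∈ Metric.ball (0 : Space n) (ρ + 1), χ x * e x = e x := by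
    intro x hx
    have : χ x = 1 := χ.one_of_mem_closedBall (Metric.ball_subset_closedBall hx)
    rw [this, one_mul]
  have hd1 : ∀ i, ∀ x ∈ Metric.ball (0 : Space n) (ρ + 1),
      pderiv i (fun x => χ x * e x) x = l * θ i * e x := by
    intro i x hx
    have : (fun x => χ x * e x) =ᶠ[nhds x] e :=
      Filter.eventually_of_mem (hopen.mem_nhds hx) hbe
    rw [pderiv, this.fderiv_eq, ← pderiv, hed]
  have hd2 : ∀ i, ∀ x ∈ Metric.ball (0 : Space n) (ρ + 1),
      pderiv i (pderiv i (fun x => χ x * e x)) x = l * θ i * (l * θ i * e x) := by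
    intro i x hx
    have : pderiv i (fun x => χ x * e x) =ᶠ[nhds x] fun x => l * θ i * e x :=
      Filter.eventually_of_mem (hopen.mem_nhds hx) (hd1 i)
    rw [pderiv, this.fderiv_eq, fderiv_const_mul (he.differentiable (by simp) x)]
    rw [← hed i x]
    rfl
  refine ⟨fun x => χ x * e x, χ.contDiff.mul he, χ.hasCompactSupport.mul_right,
    fun x => mul_nonneg χ.nonneg (Real.exp_pos _).le, fun x hx => ?_⟩
  have hx : x ∈ Metric.ball (0 : Space n) (ρ + 1) := by
    rw [Metric.mem_ball, dist_zero_right]; linarith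
  refine ⟨hbe x hx, ?_⟩
  rw [classicalLaplacian, Finset.sum_congr rfl fun i _ => hd2 i x hx]
  have hsum : ∑ i, θ i ^ 2 = 1 := by
    rw [← EuclideanSpace.real_norm_sq_eq, hθ]; norm_num
  calc _ = l ^ 2 * (∑ i, θ i ^ 2) * e x := by
        rw [Finset.mul_sum, Finset.sum_mul]
        exact Finset.sum_congr rfl fun i _ => by ring
    _ = _ := by rw [hsum, mul_one]

end

/-! ### Jointly measurable representatives on the light cone -/

section

/-- Lebesgue measure on `(0, M] × ℝⁿ`. -/
abbrev slab (n : ℕ) (M : ℝ) : Measure (ℝ × Space n) :=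
  (volume.restrict (Ioc 0 M)).prod volume

lemma ae_slab_mem {n : ℕ} (M : ℝ) : ∀ᵐ z ∂(slab n M), z.1 ∈ Ioc 0 M := by
  rw [slab, ← Measure.restrict_univ (μ := (volume : Measure (Space n))), Measure.prod_restrict]
  filter_upwards [ae_restrict_mem (measurableSet_Ioc.prod MeasurableSet.univ)] with z hz
  exact hz.1

lemma slab_mono {n : ℕ} {M M₁ : ℝ} (h : M ≤ M₁) : slab n M ≤ slab n M₁ := by
  rw [slab, slab, ← Measure.restrict_univ (μ := (volume : Measure (Space n))),
    Measure.prod_restrict, Measure.prod_restrict]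
  exact Measure.restrict_mono (prod_mono (Ioc_subset_Ioc_right h) subset_rfl) le_rfl

/-- `U` is a jointly measurable representative on `(0, M] × ℝⁿ` of the curve `u`, vanishing outside
of the light cone, with integrable `p`-th power. -/
structure IsRepresentative {n : ℕ} (p R M : ℝ) (u : ℝ → H2 n) (U : ℝ × Space n → ℝ) : Prop where
  measurable : Measurable U
  ae_eq : ∀ s ∈ Ioc 0 M, (fun x => U (s, x)) =ᵐ[volume] (u s).toL2
  eq_zero : ∀ s x, R + s < ‖x‖ → U (s, x) = 0
  integrable : Integrable (fun z => |U z| ^ p) (slab n M)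

lemma IsRepresentative.mono {n : ℕ} {p R M M₁ : ℝ} {u : ℝ → H2 n} {U : ℝ × Space n → ℝ}
    (h : IsRepresentative p R M₁ u U) (hM : M ≤ M₁) : IsRepresentative p R M u U :=
  ⟨h.measurable, fun s hs => h.ae_eq s ⟨hs.1, hs.2.trans hM⟩, h.eq_zero,
    h.integrable.mono_measure (slab_mono hM)⟩

variable {n : ℕ} {β p ε : ℝ} {u₀ : H2 n} {u₁ : H1 n} {u₂ : L2 n} {T : EReal} {u : ℝ → H2 n}

lemma enorm_abs_rpow (x : ℝ) (hp : 0 ≤ p) : ‖|x| ^ p‖ₑ = ‖x‖ₑ ^ p := by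
  rw [Real.enorm_rpow_of_nonneg (abs_nonneg _) hp]
  congr 1
  simp [Real.enorm_eq_ofReal_abs]

/-- The support condition holds for each time only up to a null set. Truncating a measurable
representative to the cone makes it hold everywhere, and then the local `L^p` bound on the ball of
radius `R + M` is a bound on the whole slab. -/
lemma IsEnergySolution.exists_isRepresentative (h : IsEnergySolution β p ε u₀ u₁ u₂ T u)
    (hp : 0 < p) {R M : ℝ} (hM0 : 0 < M) (hM : (M : EReal) < T)
    (hsupp : ∀ t : ℝ, 0 < t → (t : EReal) < T → SupportedInBall (R + t) (u t).toL2) :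
    ∃ U : ℝ × Space n → ℝ, IsRepresentative p R M u U := by
  have hv : ContinuousOn (fun s => (u s).toL2) (Icc 0 M) :=
    h.contDiffOn_L2.continuousOn.mono (Icc_subset_timeInterval hM)
  obtain ⟨V, hVm, hV⟩ := exists_measurable_uncurry_ae_eq hM0.le hv
  have hset : MeasurableSet {z : ℝ × Space n | ‖z.2‖ ≤ R + z.1} :=
    measurableSet_le (by fun_prop) (by fun_prop)
  let U := {z : ℝ × Space n | ‖z.2‖ ≤ R + z.1}.indicator V
  have hUm : Measurable U := hVm.indicator hset
  have hU0 : ∀ s x, R + s < ‖x‖ → U (s, x) = 0 := fun s x hx =>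
    indicator_of_notMem (by simpa using hx) _
  have hUe : ∀ s ∈ Ioc 0 M, (fun x => U (s, x)) =ᵐ[volume] (u s).toL2 := by
    intro s hs
    filter_upwards [hV s ⟨hs.1.le, hs.2⟩, hsupp s hs.1
      (lt_of_le_of_lt (EReal.coe_le_coe_iff.2 hs.2) hM)] with x hx hx'
    simp only [U, indicator_apply, mem_ofPred_eq]
    split_ifs with hle
    · exact hx
    · exact (hx' (not_le.1 hle)).symm
  refine ⟨U, hUm, hUe, hU0, (hUm.abs.pow_const p).aestronglyMeasurable, ?_⟩
  rw [HasFiniteIntegral, lintegral_prod _ (by fun_prop)]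
  have hfin := h.inLpLoc M ⟨hM0.le, hM⟩ (R + M)
  refine lt_of_le_of_lt ?_ hfin
  refine le_trans ?_ (lintegral_mono_set Ioc_subset_Icc_self)
  refine setLIntegral_mono' measurableSet_Ioc fun s hs => ?_
  have : ∫⁻ x, ‖|U (s, x)| ^ p‖ₑ
      = ∫⁻ x in Metric.closedBall (0 : Space n) (R + M), ‖|U (s, x)| ^ p‖ₑ := by
    refine (setLIntegral_eq_of_support_subset ?_).symm
    intro x hx
    by_contra hxb
    rw [mem_closedBall_zero_iff, not_le] at hxb
    exact hx (by simp [hU0 s x (by linarith [hs.2]), hp.ne'])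
  rw [this]
  refine (setLIntegral_congr_fun_ae measurableSet_closedBall ?_).le
  filter_upwards [hUe s hs] with x hx _
  rw [enorm_abs_rpow _ hp.le, hx]

end

/-! ### Testing with a single plane wave -/

section

variable {n : ℕ} {β p ε : ℝ} {u₀ : H2 n} {u₁ : H1 n} {u₂ : L2 n} {T : EReal} {u : ℝ → H2 n}

/-- The plane wave `exp (-l (s + R + 1) + l ⟪θ, x⟫)`. -/
def planeWave {n : ℕ} (R l : ℝ) (θ : Space n) (z : ℝ × Space n) : ℝ :=
  Real.exp (-(l * (z.1 + R + 1))) * Real.exp (l * inner ℝ θ z.2)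

lemma IsRepresentative.integral_eq {R M : ℝ} {U : ℝ × Space n → ℝ}
    (hU : IsRepresentative p R M u U) {b : Space n → ℝ} {s : ℝ} (hs : s ∈ Ioc 0 M) :
    ∫ x, (u s).toL2 x * b x = ∫ x, U (s, x) * b x := by
  refine integral_congr_ae ?_
  filter_upwards [hU.ae_eq s hs] with x hx
  rw [hx]

lemma IsRepresentative.integrable_mul {R M : ℝ} {U : ℝ × Space n → ℝ}
    (hU : IsRepresentative p R M u U) {b : Space n → ℝ} (hb : Continuous b)
    (hc : HasCompactSupport b) :
    Integrable (fun z => b z.2 * |U z| ^ p) (slab n M) := by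
  obtain ⟨B, hB⟩ := hb.bounded_above_of_compact_support hc
  exact hU.integrable.bdd_mul (c := B) (hb.comp continuous_snd).aestronglyMeasurable
    (Filter.Eventually.of_forall fun z => hB z.2)

/-- The scalar identity obtained by testing with `(c - β c')(s) b(x)`, where `b` is an exponential
on the support of the solution and `c` vanishes from time `M` on. -/
lemma IsEnergySolution.integral_weighted (hβ : 0 < β)
    (h : IsEnergySolution β p ε u₀ u₁ u₂ T u)
    {R M l : ℝ} (hM0 : 0 < M) (hM : (M : EReal) < T)
    {U : ℝ × Space n → ℝ} (hU : IsRepresentative p R M u U)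
    {a a' a'' c c' : ℝ → ℝ} (ha : ContDiff ℝ ∞ a)
    (ha' : ∀ s, HasDerivAt a (a' s) s) (ha'' : ∀ s, HasDerivAt a' (a'' s) s)
    (hac : Continuous a'') (haM : ∀ s, M ≤ s → a s = 0) (haM' : a' M = 0)
    (hc : ∀ s, HasDerivAt c (c' s) s) (hacc : ∀ s, a s = c s - β * c' s) (hcM : c M = 0)
    {b : Space n → ℝ} (hb : ContDiff ℝ ∞ b) (hbc : HasCompactSupport b)
    (hbl : ∀ x, ‖x‖ ≤ R + M → classicalLaplacian b x = l ^ 2 * b x) :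
    (∫ s in (0 : ℝ)..M, (a'' s - l ^ 2 * a s) * ∫ x, U (s, x) * b x)
    = ε * (a 0 * (∫ x, u₁.toL2 x * b x) - a' 0 * ∫ x, u₀.toL2 x * b x)
      + ε * (∫ s in (0 : ℝ)..M, Real.exp (-s / β) * (a s * ∫ x, b x * (u₂ x - u₀.laplacian x)))
      + ∫ z, c z.1 * (b z.2 * |U z| ^ p) ∂(slab n M) := by
  have hid := h.identity_mul_integrated hM0 hM ha ha' ha'' hac haM haM' hb hbc
  have e1 : ∀ s ∈ Ioc 0 M, (a'' s * ∫ x, (u s).toL2 x * b x)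
        - (a s * ∫ x, (u s).toL2 x * classicalLaplacian b x)
      = (a'' s - l ^ 2 * a s) * ∫ x, U (s, x) * b x := by
    intro s hs
    have : ∫ x, (u s).toL2 x * classicalLaplacian b x = l ^ 2 * ∫ x, U (s, x) * b x := by
      rw [hU.integral_eq hs, ← integral_const_mul]
      congr 1; ext x
      by_cases hx : ‖x‖ ≤ R + M
      · rw [hbl x hx]; ring
      · rw [hU.eq_zero s x (by linarith [hs.2]), zero_mul, zero_mul, mul_zero]
    rw [this, hU.integral_eq hs]
    ring
  have hGi := hU.integrable_mul hb.continuous hbc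
  have hcc : Continuous c := continuous_iff_continuousAt.2 fun s => (hc s).continuousAt
  have hNae : ∀ s ∈ Ioc 0 M, ∫ x, b x * |(u s).toL2 x| ^ p = ∫ x, b x * |U (s, x)| ^ p := by
    intro s hs
    refine integral_congr_ae ?_
    filter_upwards [hU.ae_eq s hs] with x hx
    rw [hx]
  have hN : IntegrableOn (fun s => ∫ x, b x * |(u s).toL2 x| ^ p) (Ioc 0 M) := by
    refine (integrableOn_congr_fun (fun s hs => hNae s hs) measurableSet_Ioc).2 ?_
    exact hGi.integral_prod_left
  have e2 := integral_memory_eq hβ hM0.le hc hacc ha.continuous hcM hN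
  have e3 : ∫ τ in (0 : ℝ)..M, c τ * ∫ x, b x * |(u τ).toL2 x| ^ p
      = ∫ z, c z.1 * (b z.2 * |U z| ^ p) ∂(slab n M) := by
    obtain ⟨B, hB⟩ := isCompact_Icc.exists_bound_of_continuousOn (s := Icc 0 M) hcc.continuousOn
    have hi : Integrable (fun z => c z.1 * (b z.2 * |U z| ^ p)) (slab n M) := by
      refine hGi.bdd_mul (c := B) (hcc.comp continuous_fst).aestronglyMeasurable ?_
      filter_upwards [ae_slab_mem M] with z hz
      exact hB z.1 ⟨hz.1.le, hz.2⟩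
    rw [integral_prod _ hi, intervalIntegral.integral_of_le hM0.le]
    refine setIntegral_congr_fun measurableSet_Ioc fun s hs => ?_
    simp only
    rw [integral_const_mul, hNae s hs]
  rw [e2, e3] at hid
  rw [← hid, intervalIntegral.integral_of_le hM0.le, intervalIntegral.integral_of_le hM0.le]
  exact (setIntegral_congr_fun measurableSet_Ioc e1).symm

lemma ofReal_integral_mul_le_lintegral {R M : ℝ} (hM : 0 ≤ M) {U : ℝ × Space n → ℝ}
    (hU : IsRepresentative p R M u U) {D : ℝ → ℝ} (hD : Measurable D) {b : Space n → ℝ}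
    (hb : Measurable b) :
    ENNReal.ofReal (∫ s in (0 : ℝ)..M, D s * ∫ x, U (s, x) * b x)
      ≤ ∫⁻ z, ENNReal.ofReal (|D z.1| * (|U z| * |b z.2|)) ∂(slab n M) := by
  have hUm := hU.measurable
  rw [intervalIntegral.integral_of_le hM, lintegral_prod _ (by fun_prop)]
  refine (ENNReal.ofReal_le_ofReal (le_abs_self _)).trans ?_
  rw [← Real.enorm_eq_ofReal_abs]
  refine (enorm_integral_le_lintegral_enorm _).trans (lintegral_mono fun s => ?_)
  simp only
  rw [enorm_mul, Real.enorm_eq_ofReal_abs (D s)]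
  simp only [ENNReal.ofReal_mul (abs_nonneg _)]
  rw [lintegral_const_mul _ (by fun_prop)]
  gcongr
  refine (enorm_integral_le_lintegral_enorm _).trans (le_of_eq ?_)
  simp only [enorm_mul, Real.enorm_eq_ofReal_abs]

lemma SupportedInBall.integrable {R : ℝ} {f : L2 n} (hf : SupportedInBall R f) :
    Integrable (fun x => f x) := by
  have : (fun x => f x) =ᵐ[volume]
      (Metric.closedBall (0 : Space n) R).indicator (fun x => f x) := by
    filter_upwards [hf] with x hx
    by_cases hm : x ∈ Metric.closedBall (0 : Space n) R
    · rw [indicator_of_mem hm]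
    · rw [indicator_of_notMem hm]
      exact hx (by simpa using hm)
  rw [integrable_congr this, integrable_indicator_iff measurableSet_closedBall]
  have : IsFiniteMeasure (volume.restrict (Metric.closedBall (0 : Space n) R)) :=
    isFiniteMeasure_restrict.2 measure_closedBall_lt_top.ne
  exact ((Lp.memLp f).restrict _).integrable (by norm_num)

/-- The left side is the coefficient left over when the wave operator hits the cut-off plane wave.
Since `M ≥ 1`, the mixed terms `l/M²` and `1/M³` are absorbed into `l/M` and `1/M²`. -/
lemma abs_symbol_le {l M C W x y z : ℝ} (hβ : 0 ≤ β) (hl : 0 ≤ l) (hM : 1 ≤ M) (hx : 0 ≤ x)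
    (hxW : x ≤ C * W) (hy : |y| ≤ C * W) (hz : |z| ≤ C * W) :
    |(l * (2 + 2 * β * l)) / M * x + (-((1 + 3 * β * l) / M ^ 2 * y) + β / M ^ 3 * z)|
      ≤ C * (2 + 3 * β) * W * (1 / M ^ 2 + l / M + l ^ 2 / M) := by
  have hM0 : 0 < M := by linarith
  have f1 : (l * (2 + 2 * β * l)) / M * x ≤ (l * (2 + 2 * β * l)) / M * (C * W) := by gcongr
  have f2 : |(1 + 3 * β * l) / M ^ 2 * y| ≤ (1 + 3 * β * l) / M ^ 2 * (C * W) := by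
    rw [abs_mul, abs_of_nonneg (by positivity)]
    gcongr
  have f3 : |β / M ^ 3 * z| ≤ β / M ^ 3 * (C * W) := by
    rw [abs_mul, abs_of_nonneg (by positivity)]
    gcongr
  have f0 : 0 ≤ (l * (2 + 2 * β * l)) / M * x := by positivity
  have f4 : 1 / M ^ 2 ≤ 1 / M := by
    rw [div_le_div_iff₀ (by positivity) hM0]; nlinarith
  have f5 : 1 / M ^ 3 ≤ 1 / M ^ 2 := by
    rw [div_le_div_iff₀ (by positivity) (by positivity)]; nlinarith [pow_pos hM0 2]
  have f6 := abs_add_le (-((1 + 3 * β * l) / M ^ 2 * y)) (β / M ^ 3 * z)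
  rw [abs_neg] at f6
  have hCW : 0 ≤ C * W := hx.trans hxW
  have key : (l * (2 + 2 * β * l)) / M + ((1 + 3 * β * l) / M ^ 2 + β / M ^ 3)
      ≤ (2 + 3 * β) * (1 / M ^ 2 + l / M + l ^ 2 / M) := by
    have g1 : 3 * β * l * (1 / M ^ 2) ≤ 3 * β * l * (1 / M) := by gcongr
    have g2 : β * (1 / M ^ 3) ≤ β * (1 / M ^ 2) := by gcongr
    have g3 : 0 ≤ (1 + 2 * β) * (1 / M ^ 2) + (2 + β) * (l ^ 2 * (1 / M)) := by positivity
    calc _ = 2 * l * (1 / M) + 2 * β * l ^ 2 * (1 / M) + 1 / M ^ 2 + 3 * β * l * (1 / M ^ 2)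
          + β * (1 / M ^ 3) := by ring
      _ ≤ (2 + 3 * β) * (1 / M ^ 2 + l * (1 / M) + l ^ 2 * (1 / M)) := by linarith
      _ = _ := by ring
  refine (abs_add_le _ _).trans ?_
  rw [abs_of_nonneg f0]
  calc _ ≤ ((l * (2 + 2 * β * l)) / M + ((1 + 3 * β * l) / M ^ 2 + β / M ^ 3)) * (C * W) := by
        linarith
    _ ≤ ((2 + 3 * β) * (1 / M ^ 2 + l / M + l ^ 2 / M)) * (C * W) := by gcongr
    _ = _ := by ring

set_option maxHeartbeats 600000 in
/-- Testing with a plane wave `planeWave R l θ` times a cut-off in time at scale `M`. -/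
lemma IsEnergySolution.lintegral_planeWave_le (hβ : 0 < β) (hp : 1 < p) (hε : 0 < ε)
    (h : IsEnergySolution β p ε u₀ u₁ u₂ T u)
    {R M : ℝ} (hR : 0 < R) (hM1 : 1 ≤ M) (hM : (M : EReal) < T)
    (hu₀ : Nonneg u₀.toL2) (hu₀s : SupportedInBall R u₀.toL2) (hu₁ : Nonneg u₁.toL2)
    (hu₂ : Nonneg (u₂ - u₀.laplacian))
    {C : ℝ} {η w w' w'' : ℝ → ℝ} (hη : IsCutoff p C η w w' w'')
    {U : ℝ × Space n → ℝ} (hU : IsRepresentative p R M u U)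
    {l : ℝ} (hl : 0 < l) {θ : Space n} (hθ : ‖θ‖ = 1) :
    ENNReal.ofReal (ε * (η 0 * ∫ x, u₀.toL2 x)) * ENNReal.ofReal (l * Real.exp (-((2 * R + 1) * l)))
      + ∫⁻ z, ENNReal.ofReal (η (z.1 / M) * |U z| ^ p) * ENNReal.ofReal (planeWave R l θ z)
          ∂(slab n M)
    ≤ ∫⁻ z, ENNReal.ofReal (C * (2 + 3 * β) * (w (z.1 / M) ^ (1 / p) * |U z|)) *
          ENNReal.ofReal ((1 / M ^ 2 + l / M + l ^ 2 / M) * planeWave R l θ z) ∂(slab n M) := by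
  have hM0 : 0 < M := by linarith
  have hC := hη.pos_const
  obtain ⟨b, hb, hbc, hb0, hbx⟩ := exists_smooth_exp (l := l) (ρ := R + M) (by linarith) hθ
  let X : ℝ → ℝ := fun s => Real.exp (-(l * (s + R + 1)))
  have hX0 : ∀ s, 0 < X s := fun s => Real.exp_pos _
  have hXd : ∀ s, HasDerivAt X (X s * -l) s := by
    intro s
    have := ((((hasDerivAt_id s).add_const R).add_const 1).const_mul l).fun_neg.exp
    simpa [X] using this
  have hXc : ContDiff ℝ ∞ X := by fun_prop
  have hdil : ∀ (f f' : ℝ → ℝ) (s : ℝ), (∀ s, HasDerivAt f (f' s) s) →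
      HasDerivAt (fun s => f (s / M)) (f' (s / M) / M) s := by
    intro f f' s hf
    have := (hf (s / M)).comp s ((hasDerivAt_id s).div_const M)
    simpa [Function.comp_def, div_eq_mul_inv] using this
  have hηd : ∀ s, HasDerivAt (fun s => η (s / M)) (-w (s / M) / M) s := fun s =>
    hdil η (fun s => -w s) s hη.hasDerivAt
  have hwd : ∀ s, HasDerivAt (fun s => w (s / M)) (w' (s / M) / M) s := fun s =>
    hdil w w' s hη.hasDerivAt_w
  have hwd' : ∀ s, HasDerivAt (fun s => w' (s / M)) (w'' (s / M) / M) s := fun s =>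
    hdil w' w'' s hη.hasDerivAt_w'
  have hdiv : ContDiff ℝ ∞ fun s : ℝ => s / M := by fun_prop
  have hηM : ContDiff ℝ ∞ fun s => η (s / M) := hη.contDiff.comp hdiv
  have hwM : ContDiff ℝ ∞ fun s => w (s / M) := hη.contDiff_w.comp hdiv
  have hw'eq : w' = deriv w := funext fun s => (hη.hasDerivAt_w s).deriv.symm
  have hw''eq : w'' = deriv w' := funext fun s => (hη.hasDerivAt_w' s).deriv.symm
  have hw's : ContDiff ℝ ∞ w' := by
    rw [hw'eq]; exact (contDiff_infty_iff_deriv.1 hη.contDiff_w).2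
  have hw''s : ContDiff ℝ ∞ w'' := by
    rw [hw''eq]; exact (contDiff_infty_iff_deriv.1 hw's).2
  have hw'M : Continuous fun s => w' (s / M) := hw's.continuous.comp hdiv.continuous
  have hw''M : Continuous fun s => w'' (s / M) := hw''s.continuous.comp hdiv.continuous
  have hpinv : 1 / p ≠ 0 := by positivity
  have hw'0 : ∀ s, w s = 0 → w' s = 0 := fun s hs => by
    have := hη.abs_w'_le s
    rw [hs, Real.zero_rpow hpinv, mul_zero] at this
    exact abs_nonpos_iff.1 this
  -- The time factor of the cut-off plane wave; `a` is `c - β c'` written out, and `a'`, `a''` are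
  -- its derivatives.
  let c : ℝ → ℝ := fun s => X s * η (s / M)
  let c' : ℝ → ℝ := fun s => X s * -l * η (s / M) + X s * (-w (s / M) / M)
  have hc : ∀ s, HasDerivAt c (c' s) s := fun s => (hXd s).fun_mul (hηd s)
  let a : ℝ → ℝ := fun s => X s * ((1 + β * l) * η (s / M) + β / M * w (s / M))
  let a' : ℝ → ℝ := fun s => X s * (-(l * (1 + β * l)) * η (s / M)
    - (1 + 2 * β * l) / M * w (s / M) + β / M ^ 2 * w' (s / M))
  let a'' : ℝ → ℝ := fun s => X s * (l ^ 2 * (1 + β * l) * η (s / M)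
    + (l * (2 + 3 * β * l)) / M * w (s / M) - (1 + 3 * β * l) / M ^ 2 * w' (s / M)
    + β / M ^ 3 * w'' (s / M))
  have ha : ContDiff ℝ ∞ a :=
    hXc.mul ((contDiff_const.mul hηM).add (contDiff_const.mul hwM))
  have ha' : ∀ s, HasDerivAt a (a' s) s := by
    intro s
    refine ((hXd s).fun_mul (((hηd s).const_mul (1 + β * l)).fun_add
      ((hwd s).const_mul (β / M)))).congr_deriv ?_
    simp only [a']
    field_simp
    ring
  have ha'' : ∀ s, HasDerivAt a' (a'' s) s := by
    intro s
    refine ((hXd s).fun_mul ((((hηd s).const_mul (-(l * (1 + β * l)))).fun_sub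
      ((hwd s).const_mul ((1 + 2 * β * l) / M))).fun_add
      ((hwd' s).const_mul (β / M ^ 2)))).congr_deriv ?_
    simp only [a'']
    field_simp
    ring
  have hηMc := hηM.continuous
  have hwMc := hwM.continuous
  have hXcc := hXc.continuous
  have hac : Continuous a'' :=
    hXcc.mul ((((continuous_const.mul hηMc).add (continuous_const.mul hwMc)).sub
      (continuous_const.mul hw'M)).add (continuous_const.mul hw''M))
  have hz : ∀ s, M ≤ s → η (s / M) = 0 ∧ w (s / M) = 0 := fun s hs =>
    have : 1 ≤ s / M := (one_le_div hM0).2 hs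
    ⟨hη.eq_zero _ this, hη.w_eq_zero_of_ge _ this⟩
  have haM : ∀ s, M ≤ s → a s = 0 := fun s hs => by simp [a, hz s hs]
  have haM' : a' M = 0 := by simp [a', hz M le_rfl, hw'0 _ (hz M le_rfl).2]
  have hcM : c M = 0 := by simp [c, hz M le_rfl]
  have hacc : ∀ s, a s = c s - β * c' s := fun s => by simp only [a, c, c']; ring
  have ha0 : ∀ s, 0 ≤ s → 0 ≤ a s := fun s hs => by
    have h1 := hη.nonneg (s / M) (by positivity)
    have h2 := hη.w_nonneg (s / M)
    have h3 := hX0 s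
    positivity
  have hid := h.integral_weighted hβ hM0 hM hU ha ha' ha'' hac haM haM' hc hacc hcM
    hb hbc (l := l) fun x hx => by rw [(hbx x hx).2, (hbx x hx).1]
  have hw0 : w 0 = 0 := hη.w_eq_zero_of_le 0 (by norm_num)
  have ha'0 : -a' 0 = X 0 * (l * (1 + β * l) * η 0) := by
    simp [a', hw0, hw'0 0 hw0]
  have hI1 : 0 ≤ ∫ x, u₁.toL2 x * b x := by
    refine integral_nonneg_of_ae ?_
    filter_upwards [hu₁] with x hx
    exact mul_nonneg hx (hb0 x)
  have hu₀i := hu₀s.integrable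
  -- On `B_R` the exponential is at least `e^{-lR}`. With `X 0 = e^{-l(R+1)}` this produces the
  -- factor `e^{-(2R+1)l}` of the data term.
  have hI0 : Real.exp (-(l * R)) * ∫ x, u₀.toL2 x ≤ ∫ x, u₀.toL2 x * b x := by
    rw [← integral_const_mul]
    refine integral_mono_ae (hu₀i.const_mul _)
      (integrable_mul_of_hasCompactSupport _ hb.continuous hbc) ?_
    filter_upwards [hu₀, hu₀s] with x hx0 hxs
    by_cases hxR : ‖x‖ ≤ R
    · rw [(hbx x (by linarith)).1, mul_comm]
      refine mul_le_mul_of_nonneg_left (Real.exp_le_exp.2 ?_) hx0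
      have h1 : |inner ℝ θ x| ≤ R :=
        (abs_real_inner_le_norm θ x).trans (by rw [hθ, one_mul]; exact hxR)
      nlinarith [neg_le_of_abs_le h1]
    · simp [hxs (not_le.1 hxR)]
  have hI2 : 0 ≤ ∫ s in (0 : ℝ)..M,
      Real.exp (-s / β) * (a s * ∫ x, b x * (u₂ x - u₀.laplacian x)) := by
    refine intervalIntegral.integral_nonneg hM0.le fun s hs => ?_
    refine mul_nonneg (Real.exp_pos _).le (mul_nonneg (ha0 s hs.1) (integral_nonneg_of_ae ?_))
    filter_upwards [hu₂, Lp.coeFn_sub u₂ u₀.laplacian] with x hx hx'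
    rw [hx', Pi.sub_apply] at hx
    exact mul_nonneg (hb0 x) hx
  have hI00 : 0 ≤ ∫ x, u₀.toL2 x := integral_nonneg_of_ae hu₀
  have hη0 := hη.pos_zero
  -- Only the part `l η(0) X(0) ∫ u₀ b` is kept; the `u₁` term and the part of `-a' 0` with the
  -- factor `β l` are nonnegative.
  have hdata : ε * (η 0 * ∫ x, u₀.toL2 x) * (l * Real.exp (-((2 * R + 1) * l)))
      ≤ ε * (a 0 * (∫ x, u₁.toL2 x * b x) - a' 0 * ∫ x, u₀.toL2 x * b x) := by
    rw [mul_assoc]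
    refine mul_le_mul_of_nonneg_left ?_ hε.le
    have h1 := mul_nonneg (ha0 0 le_rfl) hI1
    have h2 : -a' 0 * (Real.exp (-(l * R)) * ∫ x, u₀.toL2 x)
        ≤ -a' 0 * ∫ x, u₀.toL2 x * b x := by
      refine mul_le_mul_of_nonneg_left hI0 ?_
      rw [ha'0]
      have := hX0 0
      positivity
    have h3 : (η 0 * ∫ x, u₀.toL2 x) * (l * Real.exp (-((2 * R + 1) * l)))
        ≤ -a' 0 * (Real.exp (-(l * R)) * ∫ x, u₀.toL2 x) := by
      have e1 : Real.exp (-((2 * R + 1) * l)) = X 0 * Real.exp (-(l * R)) := by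
        simp only [X]
        rw [← Real.exp_add]; congr 1; ring
      rw [ha'0, e1]
      have h4 : 0 ≤ (η 0 * ∫ x, u₀.toL2 x) * (l * (X 0 * Real.exp (-(l * R)))) * (β * l) := by
        have := hX0 0
        positivity
      nlinarith
    linarith
  have hcb : ∀ᵐ z ∂(slab n M), 0 ≤ c z.1 * (b z.2 * |U z| ^ p) := by
    filter_upwards [ae_slab_mem M] with z hz
    exact mul_nonneg (mul_nonneg (hX0 _).le (hη.nonneg _ (div_nonneg hz.1.le hM0.le)))
      (mul_nonneg (hb0 _) (Real.rpow_nonneg (abs_nonneg _) _))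
  have hcbi : Integrable (fun z => c z.1 * (b z.2 * |U z| ^ p)) (slab n M) := by
    have hcc : Continuous c := hXcc.mul hηMc
    obtain ⟨B, hB⟩ := isCompact_Icc.exists_bound_of_continuousOn (s := Icc 0 M) hcc.continuousOn
    refine (hU.integrable_mul hb.continuous hbc).bdd_mul (c := B)
      (hcc.comp continuous_fst).aestronglyMeasurable ?_
    filter_upwards [ae_slab_mem M] with z hz
    exact hB z.1 ⟨hz.1.le, hz.2⟩
  have hsupp : ∀ᵐ z ∂(slab n M), U z = 0 ∨ b z.2 = Real.exp (l * inner ℝ θ z.2) := by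
    filter_upwards [ae_slab_mem M] with z hz
    by_cases hx : ‖z.2‖ ≤ R + M
    · exact Or.inr (hbx _ hx).1
    · exact Or.inl (hU.eq_zero z.1 z.2 (by linarith [hz.2]))
  have hnl : ∫⁻ z, ENNReal.ofReal (η (z.1 / M) * |U z| ^ p) * ENNReal.ofReal (planeWave R l θ z)
          ∂(slab n M) = ENNReal.ofReal (∫ z, c z.1 * (b z.2 * |U z| ^ p) ∂(slab n M)) := by
    rw [ofReal_integral_eq_lintegral_ofReal hcbi hcb]
    refine lintegral_congr_ae ?_
    filter_upwards [hsupp] with z hz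
    rw [← ENNReal.ofReal_mul' (by unfold planeWave; positivity)]
    congr 1
    rcases hz with hz | hz
    · rw [hz, abs_zero, Real.zero_rpow (by linarith)]; ring
    · rw [hz]; simp only [c, X, planeWave]; ring
  rw [hnl, ← ENNReal.ofReal_mul (by positivity),
    ← ENNReal.ofReal_add (by positivity) (integral_nonneg_of_ae hcb)]
  -- The memory term of the data, nonnegative because `u₂ - Δu₀ ≥ 0`, is dropped here.
  refine (ENNReal.ofReal_le_ofReal (by nlinarith [mul_nonneg hε.le hI2] : _ ≤
    ∫ s in (0 : ℝ)..M, (a'' s - l ^ 2 * a s) * ∫ x, U (s, x) * b x)).trans ?_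
  refine (ofReal_integral_mul_le_lintegral (D := fun s => a'' s - l ^ 2 * a s) hM0.le hU
    (hac.sub (continuous_const.mul ha.continuous)).measurable hb.continuous.measurable).trans ?_
  refine lintegral_mono_ae ?_
  filter_upwards [hsupp, ae_slab_mem M] with z hz hzM
  have hw1 : 0 ≤ w (z.1 / M) ^ (1 / p) := Real.rpow_nonneg (hη.w_nonneg _) _
  rw [← ENNReal.ofReal_mul (by positivity)]
  refine ENNReal.ofReal_le_ofReal ?_
  rcases hz with hz | hz
  · simp [hz]
  have hD : |a'' z.1 - l ^ 2 * a z.1| ≤ X z.1 * (C * (2 + 3 * β) * w (z.1 / M) ^ (1 / p) *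
      (1 / M ^ 2 + l / M + l ^ 2 / M)) := by
    -- The terms with the undifferentiated `η` cancel: the plane wave solves the wave equation.
    have e1 : a'' z.1 - l ^ 2 * a z.1 = X z.1 * ((l * (2 + 2 * β * l)) / M * w (z.1 / M)
        + (-((1 + 3 * β * l) / M ^ 2 * w' (z.1 / M)) + β / M ^ 3 * w'' (z.1 / M))) := by
      simp only [a'', a]; ring
    rw [e1, abs_mul, abs_of_pos (hX0 _)]
    refine mul_le_mul_of_nonneg_left ?_ (hX0 _).le
    exact abs_symbol_le hβ.le hl.le hM1 (hη.w_nonneg _) (hη.w_le _) (hη.abs_w'_le _)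
      (hη.abs_w''_le _)
  rw [hz, abs_of_pos (Real.exp_pos _)]
  calc _ ≤ X z.1 * (C * (2 + 3 * β) * w (z.1 / M) ^ (1 / p) *
      (1 / M ^ 2 + l / M + l ^ 2 / M)) * (|U z| * Real.exp (l * inner ℝ θ z.2)) := by
        gcongr
    _ = _ := by simp only [planeWave, X]; ring

end

/-! ### Superposition of plane waves -/

section

variable {n : ℕ} {β p ε : ℝ} {u₀ : H2 n} {u₁ : H1 n} {u₂ : L2 n} {T : EReal} {u : ℝ → H2 n}

/-- The direction of a nonzero vector. -/
def direction (θ : Space n) : Space n := ‖θ‖⁻¹ • θ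

lemma norm_direction {θ : Space n} (h : θ ≠ 0) : ‖direction θ‖ = 1 := by
  rw [direction, norm_smul, norm_inv, norm_norm, inv_mul_cancel₀ (norm_ne_zero_iff.2 h)]

lemma norm_direction_le (θ : Space n) : ‖direction θ‖ ≤ 1 := by
  by_cases h : θ = 0
  · simp [direction, h]
  · exact (norm_direction h).le

lemma measurable_direction : Measurable (direction : Space n → Space n) := by
  unfold direction; fun_prop

lemma abs_inner_direction_le (θ x : Space n) : |inner ℝ (direction θ) x| ≤ ‖x‖ :=
  (abs_real_inner_le_norm _ _).trans
    (mul_le_of_le_one_left (norm_nonneg _) (norm_direction_le θ))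

/-- The average over all directions `θ` of `(A - ⟪θ, x⟫) ^ (-q)`, a positive solution of the wave
equation as a function of `(A, x)`. -/
def waveAvg (q A : ℝ) (x : Space n) : ℝ≥0∞ :=
  ∫⁻ θ in Metric.ball (0 : Space n) 1, ENNReal.ofReal ((A - inner ℝ (direction θ) x) ^ (-q))

lemma measurable_waveAvg (q R : ℝ) :
    Measurable fun z : ℝ × Space n => waveAvg q (z.1 + R + 1) z.2 := by
  have hd : Measurable (direction : Space n → Space n) := measurable_direction
  have : Measurable fun y : (ℝ × Space n) × Space n =>
      ENNReal.ofReal ((y.1.1 + R + 1 - inner ℝ (direction y.2) y.1.2) ^ (-q)) := by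
    refine ENNReal.measurable_ofReal.comp (Measurable.pow_const ?_ _)
    exact (by fun_prop : Measurable fun y : (ℝ × Space n) × Space n => y.1.1 + R + 1).sub
      ((hd.comp measurable_snd).inner (measurable_snd.comp measurable_fst))
  exact this.lintegral_prod_right'

lemma lintegral_rpow_mul_exp {q r : ℝ} (hq : 0 < q) (hr : 0 < r) :
    ∫⁻ l in Ioi 0, ENNReal.ofReal (l ^ (q - 1) * Real.exp (-(r * l)))
      = ENNReal.ofReal (Real.Gamma q) * ENNReal.ofReal (r ^ (-q)) := by
  have h := Real.integral_rpow_mul_exp_neg_mul_Ioi hq hr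
  have hG := Real.Gamma_pos_of_pos hq
  have hne : ∫ l in Ioi 0, l ^ (q - 1) * Real.exp (-(r * l)) ≠ 0 := by
    rw [h]; positivity
  rw [← ofReal_integral_eq_lintegral_ofReal (Integrable.of_integral_ne_zero hne), h,
    ← ENNReal.ofReal_mul hG.le, one_div, Real.inv_rpow hr.le, Real.rpow_neg hr.le, mul_comm]
  filter_upwards [ae_restrict_mem measurableSet_Ioi] with l hl
  exact mul_nonneg (Real.rpow_nonneg (le_of_lt hl) _) (Real.exp_pos _).le

/-- The parameter space of plane waves: direction and frequency. -/
abbrev waveParam (n : ℕ) : Measure (Space n × ℝ) :=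
  (volume.restrict (Metric.ball (0 : Space n) 1)).prod (volume.restrict (Ioi 0))

lemma measurable_planeWave (R : ℝ) :
    Measurable fun y : (Space n × ℝ) × (ℝ × Space n) =>
      planeWave R y.1.2 (direction y.1.1) y.2 := by
  have hd : Measurable (direction : Space n → Space n) := measurable_direction
  unfold planeWave
  refine Measurable.mul (by fun_prop) (Real.measurable_exp.comp (Measurable.mul (by fun_prop) ?_))
  exact (hd.comp (measurable_fst.comp measurable_fst)).inner (measurable_snd.comp measurable_snd)

/-- Integrating in `l` is the Gamma integral with rate `r = s+R+1-⟨θ,x⟩`. The shift by `1` in the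
plane wave keeps `r ≥ 1` on the cone, so the integral converges and is not singular at its boundary.
-/
lemma lintegral_planeWave {q R : ℝ} (hq : 0 < q) {z : ℝ × Space n} (hz : ‖z.2‖ ≤ R + z.1) :
    ∫⁻ y, ENNReal.ofReal (y.2 ^ (q - 1) * planeWave R y.2 (direction y.1) z) ∂(waveParam n)
      = ENNReal.ofReal (Real.Gamma q) * waveAvg q (z.1 + R + 1) z.2 := by
  have hm : Measurable fun y : Space n × ℝ =>
      ENNReal.ofReal (y.2 ^ (q - 1) * planeWave R y.2 (direction y.1) z) := by
    have h1 : Measurable fun y : Space n × ℝ => planeWave R y.2 (direction y.1) z :=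
      (measurable_planeWave R).comp (measurable_id.prodMk measurable_const)
    fun_prop
  have hmV : Measurable fun θ : Space n =>
      ENNReal.ofReal ((z.1 + R + 1 - inner ℝ (direction θ) z.2) ^ (-q)) :=
    ENNReal.measurable_ofReal.comp (Measurable.pow_const
      (measurable_const.sub (measurable_direction.inner measurable_const)) _)
  rw [lintegral_prod _ hm.aemeasurable, waveAvg, ← lintegral_const_mul _ hmV]
  refine lintegral_congr fun θ => ?_
  have hr : 0 < z.1 + R + 1 - inner ℝ (direction θ) z.2 := by
    have := (le_abs_self _).trans (abs_inner_direction_le θ z.2)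
    linarith
  rw [← lintegral_rpow_mul_exp hq hr]
  refine lintegral_congr fun l => ?_
  rw [planeWave, ← Real.exp_add]
  congr 3
  ring

/-- The weight of the initial data after superposition: positive, finite, and depending only on `q`,
`R` and the dimension. -/
lemma lintegral_waveParam_data {q R : ℝ} (hq : 0 < q) (hR : 0 < R) :
    ∃ a : ℝ, 0 < a ∧ ∫⁻ y, ENNReal.ofReal (y.2 ^ (q - 1)) *
      ENNReal.ofReal (y.2 * Real.exp (-((2 * R + 1) * y.2))) ∂(waveParam n) = ENNReal.ofReal a := by
  have hG := Real.Gamma_pos_of_pos (by linarith : 0 < q + 1)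
  have hvol : 0 < volume.real (Metric.ball (0 : Space n) 1) :=
    ENNReal.toReal_pos (Metric.measure_ball_pos _ _ one_pos).ne' measure_ball_lt_top.ne
  refine ⟨Real.Gamma (q + 1) * (2 * R + 1) ^ (-(q + 1)) *
    volume.real (Metric.ball (0 : Space n) 1), by positivity, ?_⟩
  rw [lintegral_prod _ (by fun_prop)]
  have : ∫⁻ l in Ioi (0 : ℝ), ENNReal.ofReal (l ^ (q - 1)) *
      ENNReal.ofReal (l * Real.exp (-((2 * R + 1) * l)))
      = ENNReal.ofReal (Real.Gamma (q + 1)) * ENNReal.ofReal ((2 * R + 1) ^ (-(q + 1))) := by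
    rw [← lintegral_rpow_mul_exp (by linarith) (by linarith)]
    refine setLIntegral_congr_fun measurableSet_Ioi fun l hl => ?_
    have hl : 0 < l := hl
    rw [← ENNReal.ofReal_mul (by positivity), ← mul_assoc, add_sub_cancel_right,
      ← Real.rpow_add_one hl.ne', sub_add_cancel]
  rw [lintegral_congr fun _ => this, lintegral_const, ENNReal.ofReal_mul (by positivity),
    ENNReal.ofReal_mul hG.le, Measure.restrict_apply MeasurableSet.univ, univ_inter,
    ofReal_measureReal measure_ball_lt_top.ne]

/-- One power of `A - ⟨θ,x⟩ ≤ 2A` is traded for a larger exponent. This costs a factor of order `M`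
and so turns the `1/M²` term of the symbol into the common order `1/M`. -/
lemma waveAvg_le_mul_waveAvg_succ {q A B : ℝ} {x : Space n} (hx : ‖x‖ < A) (hB : 2 * A ≤ B) :
    waveAvg q A x ≤ ENNReal.ofReal B * waveAvg (q + 1) A x := by
  rw [waveAvg, waveAvg, ← lintegral_const_mul' _ _ ENNReal.ofReal_ne_top]
  refine lintegral_mono fun θ => ?_
  have h1 := abs_le.1 (abs_inner_direction_le θ x)
  have hr : 0 < A - inner ℝ (direction θ) x := by linarith
  simp only
  rw [← ENNReal.ofReal_mul (by linarith [norm_nonneg x])]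
  refine ENNReal.ofReal_le_ofReal ?_
  have : (A - inner ℝ (direction θ) x) ^ (-q)
      = (A - inner ℝ (direction θ) x) * (A - inner ℝ (direction θ) x) ^ (-(q + 1)) := by
    have := Real.rpow_add hr 1 (-(q + 1))
    rw [Real.rpow_one] at this
    rw [← this]
    congr 1; ring
  rw [this]
  gcongr
  linarith

/-- Here the base `A - ⟨θ,x⟩` is at least `1`, so raising the exponent only decreases the average;
this removes the `l²/M` term. -/
lemma waveAvg_succ_le {q A : ℝ} {x : Space n} (hx : ‖x‖ + 1 ≤ A) :
    waveAvg (q + 1) A x ≤ waveAvg q A x := by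
  refine lintegral_mono fun θ => ENNReal.ofReal_le_ofReal ?_
  have h1 := abs_le.1 (abs_inner_direction_le θ x)
  exact Real.rpow_le_rpow_of_exponent_le (by linarith) (by linarith)

lemma lintegral_mul_lintegral_swap {Y Z : Type*} [MeasurableSpace Y] [MeasurableSpace Z]
    {μ : Measure Y} {ν : Measure Z} [SFinite μ] [SFinite ν] {K : Y → ℝ≥0∞} {F : Z → ℝ≥0∞}
    {E : Y → Z → ℝ≥0∞} (hK : Measurable K) (hF : Measurable F)
    (hE : Measurable fun y : Y × Z => E y.1 y.2) :
    ∫⁻ y, K y * ∫⁻ z, F z * E y z ∂ν ∂μ = ∫⁻ z, F z * ∫⁻ y, K y * E y z ∂μ ∂ν := by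
  calc _ = ∫⁻ y, ∫⁻ z, K y * (F z * E y z) ∂ν ∂μ := by
        refine lintegral_congr fun y => (lintegral_const_mul _ ?_).symm
        exact hF.mul (hE.comp (measurable_const.prodMk measurable_id))
    _ = ∫⁻ z, ∫⁻ y, K y * (F z * E y z) ∂μ ∂ν := by
        refine lintegral_lintegral_swap (Measurable.aemeasurable ?_)
        exact (hK.comp measurable_fst).mul ((hF.comp measurable_snd).mul hE)
    _ = _ := by
        refine lintegral_congr fun z => ?_
        rw [← lintegral_const_mul]
        · exact lintegral_congr fun y => mul_left_comm _ _ _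
        · exact hK.mul (hE.comp (measurable_id.prodMk measurable_const))

/-- The basic inequality obtained by testing with a superposition of plane waves. -/
lemma exists_lintegral_waveAvg_le (hβ : 0 < β) (hp : 1 < p) {q R : ℝ} (hn : 2 ≤ n)
    (hq : 0 < q) (hR : 0 < R) (hu₀ : Nonneg u₀.toL2) (hu₀s : SupportedInBall R u₀.toL2)
    (hu₀0 : u₀.toL2 ≠ 0)
    (hu₁ : Nonneg u₁.toL2) {C : ℝ} {η w w' w'' : ℝ → ℝ} (hη : IsCutoff p C η w w' w'') :
    ∃ a₁ a₂ a₃ : ℝ, 0 < a₁ ∧ 0 < a₂ ∧ 0 < a₃ ∧ ∀ (ε : ℝ) (u₂ : L2 n) (T : EReal) (u : ℝ → H2 n)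
      (M : ℝ) (U : ℝ × Space n → ℝ), 0 < ε → Nonneg (u₂ - u₀.laplacian) →
      IsEnergySolution β p ε u₀ u₁ u₂ T u → 1 ≤ M → (M : EReal) < T →
      IsRepresentative p R M u U →
      ENNReal.ofReal (a₁ * ε) + ENNReal.ofReal a₂ *
          ∫⁻ z, ENNReal.ofReal (η (z.1 / M) * |U z| ^ p) * waveAvg q (z.1 + R + 1) z.2 ∂(slab n M)
        ≤ ENNReal.ofReal (a₃ / M) * ∫⁻ z, ENNReal.ofReal (w (z.1 / M) ^ (1 / p) * |U z|) *
            waveAvg (q + 1) (z.1 + R + 1) z.2 ∂(slab n M) := by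
  obtain ⟨a, ha, hdata⟩ := lintegral_waveParam_data (n := n) hq hR
  -- The hypothesis `u₀ ≢ 0` enters here: it makes the coefficient of `ε` strictly positive.
  have hI : 0 < ∫ x, u₀.toL2 x := by
    rw [integral_pos_iff_support_of_nonneg_ae hu₀ hu₀s.integrable, pos_iff_ne_zero]
    intro h0
    refine hu₀0 ((Lp.eq_zero_iff_ae_eq_zero).2 ?_)
    exact ae_iff.2 h0
  have hη0 := hη.pos_zero
  have hC := hη.pos_const
  have hG := Real.Gamma_pos_of_pos hq
  have hG1 := Real.Gamma_pos_of_pos (by linarith : 0 < q + 1)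
  have hG2 := Real.Gamma_pos_of_pos (by linarith : 0 < q + 2)
  refine ⟨η 0 * (∫ x, u₀.toL2 x) * a, Real.Gamma q, C * (2 + 3 * β) *
    (Real.Gamma q * (2 * (R + 2)) + Real.Gamma (q + 1) + Real.Gamma (q + 2)), by positivity, hG,
    by positivity, ?_⟩
  intro ε u₂ T u M U hε hu₂ h hM1 hM hU
  have hM0 : 0 < M := by linarith
  -- In positive dimension the origin, which has no direction, is a null set.
  have : Nonempty (Fin n) := ⟨⟨0, by omega⟩⟩
  have hUm := hU.measurable
  have hηm : Measurable η := hη.contDiff.continuous.measurable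
  have hwm : Measurable w := hη.contDiff_w.continuous.measurable
  have hpw := measurable_planeWave (n := n) R
  have hae : ∀ᵐ y ∂(waveParam n), 0 < y.2 ∧ y.1 ≠ 0 := by
    have h1 : ∀ᵐ θ ∂(volume.restrict (Metric.ball (0 : Space n) 1)), θ ≠ 0 :=
      ae_restrict_of_ae (compl_mem_ae_iff.2 (measure_singleton 0))
    have h2 : ∀ᵐ l ∂(volume.restrict (Ioi (0 : ℝ))), 0 < l := ae_restrict_mem measurableSet_Ioi
    filter_upwards [Measure.quasiMeasurePreserving_fst.ae h1,
      Measure.quasiMeasurePreserving_snd.ae h2] with y hy1 hy2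
    exact ⟨hy2, hy1⟩
  have hUz : ∀ᵐ z ∂(slab n M), z.1 ∈ Ioc 0 M ∧ (U z ≠ 0 → ‖z.2‖ ≤ R + z.1) := by
    filter_upwards [ae_slab_mem M] with z hz
    refine ⟨hz, fun h0 => ?_⟩
    by_contra hlt
    exact h0 (hU.eq_zero z.1 z.2 (not_le.1 hlt))
  have hmain : ∫⁻ y, ENNReal.ofReal (y.2 ^ (q - 1)) *
      (ENNReal.ofReal (ε * (η 0 * ∫ x, u₀.toL2 x)) *
        ENNReal.ofReal (y.2 * Real.exp (-((2 * R + 1) * y.2)))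
      + ∫⁻ z, ENNReal.ofReal (η (z.1 / M) * |U z| ^ p) *
          ENNReal.ofReal (planeWave R y.2 (direction y.1) z) ∂(slab n M)) ∂(waveParam n)
      ≤ ∫⁻ y, ENNReal.ofReal (y.2 ^ (q - 1)) *
        (∫⁻ z, ENNReal.ofReal (C * (2 + 3 * β) * (w (z.1 / M) ^ (1 / p) * |U z|)) *
          ENNReal.ofReal ((1 / M ^ 2 + y.2 / M + y.2 ^ 2 / M) *
            planeWave R y.2 (direction y.1) z) ∂(slab n M)) ∂(waveParam n) := by
    refine lintegral_mono_ae ?_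
    filter_upwards [hae] with y hy
    gcongr
    exact h.lintegral_planeWave_le hβ hp hε hR hM1 hM hu₀ hu₀s hu₁ hu₂ hη hU hy.1
      (norm_direction hy.2)
  have hleft : ENNReal.ofReal (η 0 * (∫ x, u₀.toL2 x) * a * ε) + ENNReal.ofReal (Real.Gamma q) *
      ∫⁻ z, ENNReal.ofReal (η (z.1 / M) * |U z| ^ p) * waveAvg q (z.1 + R + 1) z.2 ∂(slab n M)
      = ∫⁻ y, ENNReal.ofReal (y.2 ^ (q - 1)) *
      (ENNReal.ofReal (ε * (η 0 * ∫ x, u₀.toL2 x)) *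
        ENNReal.ofReal (y.2 * Real.exp (-((2 * R + 1) * y.2)))
      + ∫⁻ z, ENNReal.ofReal (η (z.1 / M) * |U z| ^ p) *
          ENNReal.ofReal (planeWave R y.2 (direction y.1) z) ∂(slab n M)) ∂(waveParam n) := by
    simp only [mul_add]
    rw [lintegral_add_left (by fun_prop), lintegral_mul_lintegral_swap (by fun_prop) (by fun_prop)
      (by fun_prop)]
    congr 1
    · calc _ = ENNReal.ofReal (ε * (η 0 * ∫ x, u₀.toL2 x)) * ENNReal.ofReal a := by
            rw [← ENNReal.ofReal_mul (by positivity)]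
            congr 1; ring
        _ = _ := by
            rw [← hdata, ← lintegral_const_mul _ (by fun_prop)]
            exact lintegral_congr fun y => mul_left_comm _ _ _
    · rw [← lintegral_const_mul']
      · refine lintegral_congr_ae ?_
        filter_upwards [hUz] with z hz
        by_cases h0 : U z = 0
        · simp [h0, (by linarith : p ≠ 0)]
        · rw [mul_left_comm, ← lintegral_planeWave hq (hz.2 h0)]
          congr 1
          refine lintegral_congr_ae ?_
          filter_upwards [hae] with y hy
          rw [ENNReal.ofReal_mul (Real.rpow_nonneg hy.1.le _)]
      · exact ENNReal.ofReal_ne_top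
  have hright : ∫⁻ y, ENNReal.ofReal (y.2 ^ (q - 1)) *
        (∫⁻ z, ENNReal.ofReal (C * (2 + 3 * β) * (w (z.1 / M) ^ (1 / p) * |U z|)) *
          ENNReal.ofReal ((1 / M ^ 2 + y.2 / M + y.2 ^ 2 / M) *
            planeWave R y.2 (direction y.1) z) ∂(slab n M)) ∂(waveParam n)
      ≤ ENNReal.ofReal (C * (2 + 3 * β) *
    (Real.Gamma q * (2 * (R + 2)) + Real.Gamma (q + 1) + Real.Gamma (q + 2)) / M) *
      ∫⁻ z, ENNReal.ofReal (w (z.1 / M) ^ (1 / p) * |U z|) *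
            waveAvg (q + 1) (z.1 + R + 1) z.2 ∂(slab n M) := by
    have hE : Measurable fun y : (Space n × ℝ) × (ℝ × Space n) =>
        ENNReal.ofReal ((1 / M ^ 2 + y.1.2 / M + y.1.2 ^ 2 / M) *
          planeWave R y.1.2 (direction y.1.1) y.2) := by fun_prop
    rw [lintegral_mul_lintegral_swap (by fun_prop) (by fun_prop) hE,
      ← lintegral_const_mul' _ _ ENNReal.ofReal_ne_top]
    refine lintegral_mono_ae ?_
    filter_upwards [hUz] with z hz
    by_cases h0 : U z = 0
    · simp [h0]
    have hx := hz.2 h0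
    have hV1 : waveAvg q (z.1 + R + 1) z.2 ≤
        ENNReal.ofReal (2 * (R + 2) * M) * waveAvg (q + 1) (z.1 + R + 1) z.2 := by
      refine waveAvg_le_mul_waveAvg_succ (by linarith) ?_
      nlinarith [hz.1.2]
    have hV2 : waveAvg (q + 2) (z.1 + R + 1) z.2 ≤ waveAvg (q + 1) (z.1 + R + 1) z.2 := by
      have := waveAvg_succ_le (q := q + 1) (x := z.2) (A := z.1 + R + 1) (by linarith)
      rwa [add_assoc, one_add_one_eq_two] at this
    have hpz : Measurable fun y : Space n × ℝ => planeWave R y.2 (direction y.1) z :=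
      hpw.comp (measurable_id.prodMk measurable_const)
    -- The three terms of the symbol shift the exponent `q` by `0`, `1` and `2`.
    have hsum : ∫⁻ y, ENNReal.ofReal (y.2 ^ (q - 1)) *
          ENNReal.ofReal ((1 / M ^ 2 + y.2 / M + y.2 ^ 2 / M) *
            planeWave R y.2 (direction y.1) z) ∂(waveParam n)
        = ENNReal.ofReal (1 / M ^ 2) *
            (ENNReal.ofReal (Real.Gamma q) * waveAvg q (z.1 + R + 1) z.2)
          + ENNReal.ofReal (1 / M) *
            (ENNReal.ofReal (Real.Gamma (q + 1)) * waveAvg (q + 1) (z.1 + R + 1) z.2)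
          + ENNReal.ofReal (1 / M) *
            (ENNReal.ofReal (Real.Gamma (q + 2)) * waveAvg (q + 2) (z.1 + R + 1) z.2) := by
      rw [← lintegral_planeWave hq hx, ← lintegral_planeWave (by linarith : 0 < q + 1) hx,
        ← lintegral_planeWave (by linarith : 0 < q + 2) hx,
        ← lintegral_const_mul' _ _ ENNReal.ofReal_ne_top,
        ← lintegral_const_mul' _ _ ENNReal.ofReal_ne_top,
        ← lintegral_const_mul' _ _ ENNReal.ofReal_ne_top,
        ← lintegral_add_left (by fun_prop), ← lintegral_add_left (by fun_prop)]
      refine lintegral_congr_ae ?_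
      filter_upwards [hae] with y hy
      have hy2 := hy.1
      have hpos : 0 < planeWave R y.2 (direction y.1) z := by unfold planeWave; positivity
      rw [← ENNReal.ofReal_mul (by positivity), ← ENNReal.ofReal_mul (by positivity),
        ← ENNReal.ofReal_mul (by positivity), ← ENNReal.ofReal_mul (by positivity),
        ← ENNReal.ofReal_add (by positivity) (by positivity),
        ← ENNReal.ofReal_add (by positivity) (by positivity)]
      congr 1
      have e1 : y.2 ^ (q + 1 - 1) = y.2 ^ (q - 1) * y.2 := by
        rw [← Real.rpow_add_one hy2.ne']; congr 1; ring
      have e2 : y.2 ^ (q + 2 - 1) = y.2 ^ (q - 1) * y.2 ^ 2 := by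
        rw [← Real.rpow_add_natCast hy2.ne']; congr 1; push_cast; ring
      rw [e1, e2]
      ring
    rw [hsum]
    set V := waveAvg (q + 1) (z.1 + R + 1) z.2
    have hW := Real.rpow_nonneg (hη.w_nonneg (z.1 / M)) (1 / p)
    calc _ ≤ ENNReal.ofReal (C * (2 + 3 * β) * (w (z.1 / M) ^ (1 / p) * |U z|)) *
          (ENNReal.ofReal (1 / M ^ 2) *
            (ENNReal.ofReal (Real.Gamma q) * (ENNReal.ofReal (2 * (R + 2) * M) * V))
          + ENNReal.ofReal (1 / M) * (ENNReal.ofReal (Real.Gamma (q + 1)) * V)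
          + ENNReal.ofReal (1 / M) * (ENNReal.ofReal (Real.Gamma (q + 2)) * V)) := by
          gcongr
      _ = ENNReal.ofReal (C * (2 + 3 * β) * (w (z.1 / M) ^ (1 / p) * |U z|)) *
          (ENNReal.ofReal (1 / M ^ 2 * (Real.Gamma q * (2 * (R + 2) * M))
            + 1 / M * Real.Gamma (q + 1) + 1 / M * Real.Gamma (q + 2)) * V) := by
          rw [ENNReal.ofReal_add (by positivity) (by positivity),
            ENNReal.ofReal_add (by positivity) (by positivity),
            ENNReal.ofReal_mul (p := 1 / M ^ 2) (by positivity),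
            ENNReal.ofReal_mul (p := Real.Gamma q) hG.le,
            ENNReal.ofReal_mul (p := 1 / M) (by positivity),
            ENNReal.ofReal_mul (p := 1 / M) (by positivity)]
          ring
      _ = _ := by
          conv_lhs => rw [← mul_assoc, ← ENNReal.ofReal_mul (by positivity)]
          conv_rhs => rw [← mul_assoc, ← ENNReal.ofReal_mul (by positivity)]
          congr 2
          field_simp
  rw [hleft]
  exact hmain.trans hright

end

/-! ### Pointwise and integral bounds for `waveAvg` -/

section

variable {n : ℕ}

lemma exists_le_waveAvg (n : ℕ) (q : ℝ) :
    ∃ c : ℝ, 0 < c ∧ ∀ (A : ℝ) (x : Space n), 0 ≤ q → ‖x‖ < A →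
      ENNReal.ofReal (c * A ^ (-q)) ≤ waveAvg q A x := by
  have hvol : 0 < volume.real (Metric.ball (0 : Space n) 1) :=
    ENNReal.toReal_pos (Metric.measure_ball_pos _ _ one_pos).ne' measure_ball_lt_top.ne
  refine ⟨2 ^ (-q) * volume.real (Metric.ball (0 : Space n) 1), by positivity, ?_⟩
  intro A x hq hx
  have hA : 0 < A := (norm_nonneg x).trans_lt hx
  calc ENNReal.ofReal (2 ^ (-q) * volume.real (Metric.ball (0 : Space n) 1) * A ^ (-q))
      = ∫⁻ _ in Metric.ball (0 : Space n) 1, ENNReal.ofReal ((2 * A) ^ (-q)) := by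
        rw [lintegral_const, Measure.restrict_apply MeasurableSet.univ, univ_inter,
          ← ofReal_measureReal measure_ball_lt_top.ne, ← ENNReal.ofReal_mul (by positivity),
          Real.mul_rpow (by positivity) (by positivity)]
        congr 1; ring
    _ ≤ _ := by
        refine lintegral_mono fun θ => ENNReal.ofReal_le_ofReal ?_
        have h1 := abs_le.1 (abs_inner_direction_le θ x)
        exact Real.rpow_le_rpow_of_nonpos (by linarith) (by linarith) (by linarith)

lemma waveAvg_map (q A : ℝ) (x : Space n) (f : Space n ≃ₗᵢ[ℝ] Space n) :
    waveAvg q A (f x) = waveAvg q A x := by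
  have hm : Measurable fun θ : Space n =>
      ENNReal.ofReal ((A - inner ℝ (direction θ) (f x)) ^ (-q)) :=
    ENNReal.measurable_ofReal.comp (Measurable.pow_const
      (measurable_const.sub (measurable_direction.inner measurable_const)) _)
  have hpre : f ⁻¹' Metric.ball (0 : Space n) 1 = Metric.ball (0 : Space n) 1 := by
    ext θ; simp
  rw [waveAvg, waveAvg, ← f.measurePreserving.setLIntegral_comp_preimage measurableSet_ball hm,
    hpre]
  refine lintegral_congr fun θ => ?_
  have : direction (f θ) = f (direction θ) := by simp [direction]
  rw [this, LinearIsometryEquiv.inner_map_map]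

lemma exists_rotation {m : ℕ} (x : Space (m + 1)) :
    ∃ f : Space (m + 1) ≃ₗᵢ[ℝ] Space (m + 1), f x = EuclideanSpace.single 0 ‖x‖ :=
  ⟨(ℝ ∙ (x - EuclideanSpace.single 0 ‖x‖))ᗮ.reflection, Submodule.reflection_sub (by simp)⟩

/-- The substitution `z ↦ (A/δ)^(1/2) z` reduces the integral to that of `(1 + ‖z‖²)^(-q)`, which
converges for `q > m/2`. -/
lemma integral_japanese_scaled {m : ℕ} {q δ A : ℝ} (hq : (m : ℝ) / 2 < q) (hδ : 0 < δ)
    (hA : 0 < A) :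
    ∫⁻ z : Fin m → ℝ, ENNReal.ofReal ((δ / 2 + A / 2 * ‖z‖ ^ 2) ^ (-q))
      = ENNReal.ofReal (2 ^ q * (∫ z : Fin m → ℝ, (1 + ‖z‖ ^ 2) ^ (-q)) *
        (A ^ (-((m : ℝ) / 2)) * δ ^ ((m : ℝ) / 2 - q))) := by
  have hJ : Integrable fun z : Fin m → ℝ => (1 + ‖z‖ ^ 2) ^ (-q) := by
    have := integrable_rpow_neg_one_add_norm_sq (E := Fin m → ℝ) (μ := volume) (r := 2 * q)
      (by rw [Module.finrank_fin_fun]; linarith)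
    have e : -(2 * q) / 2 = -q := by ring
    rwa [e] at this
  let κ : ℝ := (A / δ) ^ (1 / 2 : ℝ)
  have hκ : 0 < κ := by positivity
  have hκ2 : κ ^ 2 = A / δ := by
    rw [← Real.rpow_natCast, ← Real.rpow_mul (by positivity)]; norm_num
  have hpt : ∀ z : Fin m → ℝ, (δ / 2 + A / 2 * ‖z‖ ^ 2) ^ (-q)
      = (δ / 2) ^ (-q) * (1 + ‖κ • z‖ ^ 2) ^ (-q) := by
    intro z
    rw [← Real.mul_rpow (by positivity) (by positivity), norm_smul, mul_pow,
      Real.norm_of_nonneg hκ.le, hκ2]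
    congr 1
    field_simp
  have hκm : (κ ^ m)⁻¹ = A ^ (-((m : ℝ) / 2)) * δ ^ ((m : ℝ) / 2) := by
    rw [← Real.rpow_natCast, ← Real.rpow_mul (by positivity), Real.div_rpow hA.le hδ.le,
      inv_div, Real.rpow_neg hA.le]
    rw [one_div_mul_eq_div]
    field_simp
  simp only [hpt]
  rw [← ofReal_integral_eq_lintegral_ofReal ((hJ.comp_smul hκ.ne').const_mul _)
    (Filter.Eventually.of_forall fun z => by positivity), integral_const_mul,
    Measure.integral_comp_smul volume (fun z : Fin m → ℝ => (1 + ‖z‖ ^ 2) ^ (-q)) κ,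
    Module.finrank_fin_fun, abs_of_pos (by positivity), hκm, smul_eq_mul]
  congr 1
  rw [Real.div_rpow hδ.le (by norm_num), Real.rpow_neg (by norm_num : (0:ℝ) ≤ 2), sub_eq_add_neg,
    Real.rpow_add hδ]
  field_simp

/-- After a rotation `x` points along the first axis. Only directions close to it make `A - ⟨θ,x⟩`
small, and there it grows quadratically in the `m` transversal coordinates `θ'`: it is at least `δ/2
+ A ‖θ'‖²/2` with `δ = A - ‖x‖`. Releasing `θ'` to all of `ℝᵐ` leaves a scaled integral. -/
lemma exists_waveAvg_le (m : ℕ) {q : ℝ} (hq : (m : ℝ) / 2 < q) :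
    ∃ C : ℝ, 0 < C ∧ ∀ (A : ℝ) (x : Space (m + 1)), ‖x‖ < A →
      waveAvg q A x ≤
        ENNReal.ofReal (C * (A ^ (-((m : ℝ) / 2)) * (A - ‖x‖) ^ ((m : ℝ) / 2 - q))) := by
  set J := ∫ z : Fin m → ℝ, (1 + ‖z‖ ^ 2) ^ (-q)
  have hJ : 0 ≤ J := integral_nonneg fun z => by positivity
  refine ⟨2 * (2 ^ q * J) + 1, by positivity, ?_⟩
  intro A x hx
  have hA : 0 < A := (norm_nonneg x).trans_lt hx
  have hδ : 0 < A - ‖x‖ := sub_pos.2 hx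
  set δ := A - ‖x‖ with hδdef
  obtain ⟨f, hf⟩ := exists_rotation x
  rw [← waveAvg_map q A x f, hf]
  let e : Space (m + 1) → ℝ × (Fin m → ℝ) := fun θ => (θ 0, fun j => θ j.succ)
  have he : MeasurePreserving e volume volume := by
    have h1 := EuclideanSpace.volume_preserving_symm_measurableEquiv_toLp (Fin (m + 1))
    have h2 := volume_preserving_piFinSuccAbove (fun _ : Fin (m + 1) => ℝ) 0
    have h3 := h2.comp h1
    exact h3
  let G : ℝ × (Fin m → ℝ) → ℝ≥0∞ := fun y =>
    (Icc (-1 : ℝ) 1).indicator 1 y.1 * ENNReal.ofReal ((δ / 2 + A / 2 * ‖y.2‖ ^ 2) ^ (-q))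
  have hG1 : Measurable fun t : ℝ => (Icc (-1 : ℝ) 1).indicator (1 : ℝ → ℝ≥0∞) t :=
    measurable_one.indicator measurableSet_Icc
  have hG2 : Measurable fun y : Fin m → ℝ => ENNReal.ofReal ((δ / 2 + A / 2 * ‖y‖ ^ 2) ^ (-q)) := by
    fun_prop
  have hG : Measurable G := (hG1.comp measurable_fst).mul (hG2.comp measurable_snd)
  have hpt : ∀ θ ∈ Metric.ball (0 : Space (m + 1)) 1, ENNReal.ofReal
      ((A - inner ℝ (direction θ) (EuclideanSpace.single 0 ‖x‖)) ^ (-q)) ≤ G (e θ) := by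
    intro θ hθ
    rw [mem_ball_zero_iff] at hθ
    have hsq : ‖θ‖ ^ 2 = θ 0 ^ 2 + ∑ j : Fin m, θ j.succ ^ 2 := by
      rw [EuclideanSpace.real_norm_sq_eq, Fin.sum_univ_succ]
    set σ := ∑ j : Fin m, θ j.succ ^ 2
    have hσ : ‖(e θ).2‖ ^ 2 ≤ σ := by
      have : ‖(e θ).2‖ ≤ √σ := by
        refine (pi_norm_le_iff_of_nonneg (Real.sqrt_nonneg _)).2 fun j => ?_
        rw [Real.norm_eq_abs]
        refine Real.abs_le_sqrt ?_
        exact Finset.single_le_sum (f := fun j : Fin m => θ j.succ ^ 2)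
          (fun _ _ => sq_nonneg _) (Finset.mem_univ j)
      calc _ ≤ √σ ^ 2 := by gcongr
        _ = σ := Real.sq_sqrt (Finset.sum_nonneg fun _ _ => sq_nonneg _)
    have hσ0 : 0 ≤ σ := Finset.sum_nonneg fun _ _ => sq_nonneg _
    have hθ2 : ‖θ‖ ^ 2 ≤ 1 := by nlinarith [norm_nonneg θ]
    have hmem : θ 0 ∈ Icc (-1 : ℝ) 1 :=
      abs_le.1 ((sq_le_one_iff_abs_le_one _).1 (by nlinarith))
    simp only [G]
    rw [indicator_of_mem hmem, Pi.one_apply, one_mul]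
    refine ENNReal.ofReal_le_ofReal (Real.rpow_le_rpow_of_nonpos (by positivity) ?_ ?_)
    swap
    · have : (0 : ℝ) ≤ m := Nat.cast_nonneg m
      linarith
    have hin : inner ℝ (direction θ) (EuclideanSpace.single 0 ‖x‖) = ‖x‖ * (θ 0 / ‖θ‖) := by
      rw [EuclideanSpace.inner_single_right]
      simp only [direction, PiLp.smul_apply, smul_eq_mul, conj_trivial]
      rw [div_eq_inv_mul]
    rw [hin]
    by_cases h0 : θ = 0
    · have : σ = 0 := by simp [σ, h0]
      rw [h0]
      simp only [norm_zero, div_zero, mul_zero, sub_zero]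
      have h1 : A / 2 * ‖(e 0).2‖ ^ 2 = 0 := by
        have : (e 0).2 = 0 := by ext j; simp [e]
        simp [this]
      rw [h1]
      linarith [norm_nonneg x]
    have hθ0 : 0 < ‖θ‖ := norm_pos_iff.2 h0
    -- With `t = θ 0 / ‖θ‖` this is `1 - t ≥ (1 - t²)/2`, together with `1 - t² = σ/‖θ‖² ≥ σ`.
    have ht : σ / 2 ≤ 1 - θ 0 / ‖θ‖ := by
      have h1 : (θ 0 / ‖θ‖) ^ 2 = 1 - σ / ‖θ‖ ^ 2 := by
        field_simp; linarith
      have h2 : σ ≤ σ / ‖θ‖ ^ 2 := by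
        rw [le_div_iff₀ (by positivity)]
        exact mul_le_of_le_one_right hσ0 hθ2
      nlinarith [sq_nonneg (1 - θ 0 / ‖θ‖)]
    have hσ1 : σ ≤ 1 := by nlinarith [sq_nonneg (θ 0)]
    have h3 : ‖x‖ * (σ / 2) ≤ ‖x‖ * (1 - θ 0 / ‖θ‖) := by gcongr
    have h4 : A / 2 * ‖(e θ).2‖ ^ 2 ≤ A / 2 * σ := by gcongr
    have h5 : δ * σ ≤ δ := mul_le_of_le_one_right hδ.le hσ1
    have h6 : ‖x‖ = A - δ := by rw [hδdef]; ring
    rw [h6] at h3 ⊢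
    nlinarith
  calc _ ≤ ∫⁻ θ in Metric.ball (0 : Space (m + 1)) 1, G (e θ) :=
        setLIntegral_mono' measurableSet_ball hpt
    _ ≤ ∫⁻ θ, G (e θ) := setLIntegral_le_lintegral _ _
    _ = ∫⁻ y, G y := he.lintegral_comp hG
    _ = (∫⁻ t : ℝ, (Icc (-1 : ℝ) 1).indicator 1 t) *
        ∫⁻ z : Fin m → ℝ, ENNReal.ofReal ((δ / 2 + A / 2 * ‖z‖ ^ 2) ^ (-q)) := by
        rw [← lintegral_prod_mul hG1.aemeasurable hG2.aemeasurable]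
        rfl
    _ = ENNReal.ofReal 2 * ENNReal.ofReal (2 ^ q * J *
        (A ^ (-((m : ℝ) / 2)) * δ ^ ((m : ℝ) / 2 - q))) := by
        rw [integral_japanese_scaled hq hδ hA, lintegral_indicator_one measurableSet_Icc,
          Real.volume_Icc]
        norm_num [J]
    _ ≤ _ := by
        rw [← ENNReal.ofReal_mul (by norm_num)]
        refine ENNReal.ofReal_le_ofReal ?_
        have : 0 < A ^ (-((m : ℝ) / 2)) * δ ^ ((m : ℝ) / 2 - q) := by positivity
        nlinarith

/-- In polar coordinates the factor `y^m` is bounded by `ρ^m`; the remaining radial integral is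
logarithmic for `k = 1` and bounded for `k = 2`. -/
lemma lintegral_closedBall_le {m : ℕ} {ρ k L : ℝ} (hρ : 0 ≤ ρ)
    (hL : ∫ y in (0 : ℝ)..ρ, (ρ + 1 - y) ^ (-k) ≤ L) :
    ∫⁻ x in Metric.closedBall (0 : Space (m + 1)) ρ, ENNReal.ofReal ((ρ + 1 - ‖x‖) ^ (-k))
      ≤ ENNReal.ofReal ((m + 1) * volume.real (Metric.ball (0 : Space (m + 1)) 1) *
          (ρ ^ m * L)) := by
  let f : ℝ → ℝ := (Iic ρ).indicator fun y => (ρ + 1 - y) ^ (-k)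
  have hcont : ContinuousOn (fun x : Space (m + 1) => (ρ + 1 - ‖x‖) ^ (-k))
      (Metric.closedBall 0 ρ) := by
    refine ContinuousOn.rpow_const (by fun_prop) fun x hx => Or.inl ?_
    rw [mem_closedBall_zero_iff] at hx
    linarith
  have hint := hcont.integrableOn_compact (μ := volume) (isCompact_closedBall _ _)
  have hcont1 : ContinuousOn (fun y : ℝ => (ρ + 1 - y) ^ (-k)) (Icc 0 ρ) := by
    refine ContinuousOn.rpow_const (by fun_prop) fun x hx => Or.inl ?_
    linarith [hx.2]
  have hnn : ∀ y ≤ ρ, 0 ≤ (ρ + 1 - y) ^ (-k) := fun y hy => Real.rpow_nonneg (by linarith) _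
  have e1 : ∫ x in Metric.closedBall (0 : Space (m + 1)) ρ, (ρ + 1 - ‖x‖) ^ (-k)
      = ∫ x : Space (m + 1), f ‖x‖ := by
    rw [← integral_indicator measurableSet_closedBall]
    congr 1; ext x
    by_cases hx : ‖x‖ ≤ ρ
    · rw [indicator_of_mem (by simpa using hx)]; simp [f, hx]
    · rw [indicator_of_notMem (by simpa using hx)]; simp [f, hx]
  have e2 : ∫ y in Ioi (0 : ℝ), y ^ m • f y = ∫ y in (0 : ℝ)..ρ, y ^ m * (ρ + 1 - y) ^ (-k) := by
    have : ∀ y, y ^ m • f y = (Iic ρ).indicator (fun y => y ^ m * (ρ + 1 - y) ^ (-k)) y :=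
      fun y => by simp [f, indicator_apply]
    simp only [this]
    rw [setIntegral_indicator measurableSet_Iic, Ioi_inter_Iic, intervalIntegral.integral_of_le hρ]
  have e3 : ∫ y in (0 : ℝ)..ρ, y ^ m * (ρ + 1 - y) ^ (-k) ≤ ρ ^ m * L := by
    calc _ ≤ ∫ y in (0 : ℝ)..ρ, ρ ^ m * (ρ + 1 - y) ^ (-k) := by
          refine intervalIntegral.integral_mono_on hρ ?_ ?_ ?_
          · exact ContinuousOn.intervalIntegrable (by
              rw [uIcc_of_le hρ]
              exact (continuous_pow m).continuousOn.mul hcont1)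
          · exact ContinuousOn.intervalIntegrable (by
              rw [uIcc_of_le hρ]; exact continuousOn_const.mul hcont1)
          · intro y hy
            have := hnn y hy.2
            have := hy.1
            have := hy.2
            gcongr
      _ ≤ _ := by
          rw [intervalIntegral.integral_const_mul]
          gcongr
  rw [← ofReal_integral_eq_lintegral_ofReal hint, e1,
    integral_fun_norm_addHaar volume f, finrank_euclideanSpace_fin]
  · refine ENNReal.ofReal_le_ofReal ?_
    simp only [add_tsub_cancel_right, nsmul_eq_mul, smul_eq_mul] at e2 ⊢
    rw [e2]
    push_cast
    rw [← mul_assoc]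
    have : 0 ≤ volume.real (Metric.ball (0 : Space (m + 1)) 1) := measureReal_nonneg
    gcongr
  · filter_upwards [ae_restrict_mem measurableSet_closedBall] with x hx
    exact hnn _ (by simpa using hx)

lemma integral_inv_le {ρ : ℝ} (hρ : 0 ≤ ρ) :
    ∫ y in (0 : ℝ)..ρ, (ρ + 1 - y) ^ (-1 : ℝ) ≤ Real.log (ρ + 1) := by
  have hd : ∀ y ∈ uIcc 0 ρ, HasDerivAt (fun y => -Real.log (ρ + 1 - y))
      ((ρ + 1 - y) ^ (-1 : ℝ)) y := by
    intro y hy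
    rw [uIcc_of_le hρ] at hy
    have h := (((hasDerivAt_id y).const_sub (ρ + 1)).log (by simp; linarith [hy.2])).fun_neg
    refine h.congr_deriv ?_
    rw [Real.rpow_neg_one]
    simp [neg_div]
  rw [intervalIntegral.integral_eq_sub_of_hasDerivAt hd]
  · simp
  · refine ContinuousOn.intervalIntegrable
      (ContinuousOn.rpow_const (by fun_prop) fun y hy => Or.inl ?_)
    rw [uIcc_of_le hρ] at hy
    linarith [hy.2]

lemma integral_inv_sq_le {ρ : ℝ} (hρ : 0 ≤ ρ) :
    ∫ y in (0 : ℝ)..ρ, (ρ + 1 - y) ^ (-2 : ℝ) ≤ 1 := by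
  have hd : ∀ y ∈ uIcc 0 ρ, HasDerivAt (fun y => (ρ + 1 - y)⁻¹) ((ρ + 1 - y) ^ (-2 : ℝ)) y := by
    intro y hy
    rw [uIcc_of_le hρ] at hy
    have h := ((hasDerivAt_id y).const_sub (ρ + 1)).inv (by simp; linarith [hy.2])
    refine h.congr_deriv ?_
    rw [Real.rpow_neg (by linarith [hy.2])]
    simp
  rw [intervalIntegral.integral_eq_sub_of_hasDerivAt hd]
  · simp
    positivity
  · refine ContinuousOn.intervalIntegrable
      (ContinuousOn.rpow_const (by fun_prop) fun y hy => Or.inl ?_)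
    rw [uIcc_of_le hρ] at hy
    linarith [hy.2]

/-- The `L^{p'}` norm of `waveAvg` over the light cone between the times `M / 2` and `M`. -/
lemma exists_lintegral_waveAvg_rpow_le (m : ℕ) {q p' k R : ℝ} (hp' : 1 < p') (hk : 0 < k)
    (hR : 0 < R) (hq : q = (m : ℝ) / 2 + k / p') :
    ∃ C : ℝ, 0 < C ∧ ∀ M L : ℝ, 1 ≤ M →
      (∀ ρ, 0 ≤ ρ → ρ ≤ M + R → ∫ y in (0 : ℝ)..ρ, (ρ + 1 - y) ^ (-k) ≤ L) →
      ∫⁻ z in {z : ℝ × Space (m + 1) | M / 2 ≤ z.1 ∧ ‖z.2‖ ≤ R + z.1},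
        waveAvg q (z.1 + R + 1) z.2 ^ p' ∂(slab (m + 1) M)
      ≤ ENNReal.ofReal (C * (M ^ ((m : ℝ) + 1 - m * p' / 2) * L)) := by
  obtain ⟨C, hC, hV⟩ := exists_waveAvg_le m (q := q) (by
    rw [hq]; have : 0 < k / p' := by positivity
    linarith)
  have hvol : 0 < volume.real (Metric.ball (0 : Space (m + 1)) 1) :=
    ENNReal.toReal_pos (Metric.measure_ball_pos _ _ one_pos).ne' measure_ball_lt_top.ne
  set v := volume.real (Metric.ball (0 : Space (m + 1)) 1)
  refine ⟨C ^ p' * (1 / 2) ^ (-(m * p' / 2)) * ((m + 1) * v * (1 + R) ^ m), by positivity, ?_⟩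
  intro M L hM hL
  have hM0 : 0 < M := by linarith
  -- The hypothesis at `ρ = 0`, where the integral is zero.
  have hL0 : 0 ≤ L := by simpa using hL 0 le_rfl (by linarith)
  have hset : MeasurableSet {z : ℝ × Space (m + 1) | M / 2 ≤ z.1 ∧ ‖z.2‖ ≤ R + z.1} :=
    (measurableSet_le measurable_const measurable_fst).inter
      (measurableSet_le (f := fun z : ℝ × Space (m + 1) => ‖z.2‖) (g := fun z => R + z.1)
        (by fun_prop) (by fun_prop))
  have hVm := measurable_waveAvg (n := m + 1) q R
  rw [← lintegral_indicator hset, lintegral_prod _ ((hVm.pow_const _).indicator hset).aemeasurable]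
  -- On each time slice the exponent `m/2 - q = -k/p'` becomes `-k` after taking the power `p'`,
  -- while `s ≥ M/2` replaces the power of `s+R+1` by one of `M`.
  have hs : ∀ s ∈ Ioc 0 M, ∫⁻ x, {z : ℝ × Space (m + 1) | M / 2 ≤ z.1 ∧ ‖z.2‖ ≤ R + z.1}.indicator
      (fun z => waveAvg q (z.1 + R + 1) z.2 ^ p') (s, x)
      ≤ ENNReal.ofReal (C ^ p' * (M / 2) ^ (-(m * p' / 2)) *
        ((m + 1) * v * ((M + R) ^ m * L))) := by
    intro s hs
    by_cases hsM : M / 2 ≤ s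
    swap
    · refine le_of_eq_of_le (lintegral_eq_zero_of_ae_eq_zero ?_) zero_le
      refine Filter.Eventually.of_forall fun x => indicator_of_notMem ?_ _
      exact fun h => hsM h.1
    have h0 : ∀ x : Space (m + 1), ‖x‖ ≤ s + R → waveAvg q (s + R + 1) x ^ p' ≤
        ENNReal.ofReal (C ^ p' * (M / 2) ^ (-(m * p' / 2))) *
          ENNReal.ofReal ((s + R + 1 - ‖x‖) ^ (-k)) := by
      intro x hx
      have hd : 0 < s + R + 1 - ‖x‖ := by linarith
      have hA : 0 < s + R + 1 := by linarith [norm_nonneg x]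
      rw [← ENNReal.ofReal_mul (by positivity)]
      calc _ ≤ (ENNReal.ofReal (C * ((s + R + 1) ^ (-((m : ℝ) / 2)) *
            (s + R + 1 - ‖x‖) ^ ((m : ℝ) / 2 - q)))) ^ p' := by
            have := hV (s + R + 1) x (by linarith)
            gcongr
        _ = ENNReal.ofReal (C ^ p' * (s + R + 1) ^ (-(m * p' / 2)) *
            (s + R + 1 - ‖x‖) ^ (-k)) := by
            rw [ENNReal.ofReal_rpow_of_nonneg (by positivity) (by linarith),
              Real.mul_rpow (by positivity) (by positivity),
              Real.mul_rpow (by positivity) (by positivity), ← Real.rpow_mul hA.le,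
              ← Real.rpow_mul hd.le, ← mul_assoc]
            congr 3
            · congr 1; ring
            · rw [hq, sub_add_cancel_left, neg_mul, div_mul_cancel₀ _ (by positivity)]
        _ ≤ _ := by
            refine ENNReal.ofReal_le_ofReal ?_
            have : (s + R + 1) ^ (-(m * p' / 2)) ≤ (M / 2) ^ (-(m * p' / 2)) :=
              Real.rpow_le_rpow_of_nonpos (by positivity) (by linarith)
                (neg_nonpos.2 (by positivity))
            gcongr
    calc _ ≤ ∫⁻ x, (Metric.closedBall (0 : Space (m + 1)) (s + R)).indicator
          (fun x => ENNReal.ofReal (C ^ p' * (M / 2) ^ (-(m * p' / 2))) *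
            ENNReal.ofReal ((s + R + 1 - ‖x‖) ^ (-k))) x := by
          refine lintegral_mono fun x => ?_
          by_cases hx : ‖x‖ ≤ s + R
          · rw [indicator_of_mem (by exact ⟨hsM, by linarith⟩),
              indicator_of_mem (by simpa using hx)]
            exact h0 x hx
          · rw [indicator_of_notMem]
            · exact zero_le
            · exact fun h => hx (by linarith [h.2])
      _ ≤ ENNReal.ofReal (C ^ p' * (M / 2) ^ (-(m * p' / 2))) *
          ENNReal.ofReal ((m + 1) * v * ((s + R) ^ m * L)) := by
          rw [lintegral_indicator measurableSet_closedBall,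
            lintegral_const_mul' _ _ ENNReal.ofReal_ne_top]
          gcongr
          exact lintegral_closedBall_le (by linarith [hs.1])
            (hL _ (by linarith [hs.1]) (by linarith [hs.2]))
      _ ≤ _ := by
          rw [← ENNReal.ofReal_mul (by positivity)]
          refine ENNReal.ofReal_le_ofReal ?_
          have := hs.1
          have := hs.2
          gcongr
  refine (setLIntegral_mono' measurableSet_Ioc hs).trans ?_
  rw [lintegral_const, Measure.restrict_apply MeasurableSet.univ, univ_inter, Real.volume_Ioc,
    sub_zero, ← ENNReal.ofReal_mul (by positivity)]
  refine ENNReal.ofReal_le_ofReal ?_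
  have h1 : (M + R) ^ m ≤ (1 + R) ^ m * M ^ m := by
    rw [← mul_pow]
    gcongr
    nlinarith
  have h2 : (M / 2) ^ (-(m * p' / 2)) = (1 / 2) ^ (-(m * p' / 2)) * M ^ (-(m * p' / 2)) := by
    rw [← Real.mul_rpow (by norm_num) hM0.le]; congr 1; ring
  have h3 : M ^ ((m : ℝ) + 1 - m * p' / 2) = M ^ m * M * M ^ (-(m * p' / 2)) := by
    rw [sub_eq_add_neg, Real.rpow_add hM0, Real.rpow_add_one hM0.ne', Real.rpow_natCast]
  rw [h2, h3]
  calc _ ≤ C ^ p' * ((1 / 2) ^ (-(m * p' / 2)) * M ^ (-(m * p' / 2))) *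
        ((m + 1) * v * ((1 + R) ^ m * M ^ m * L)) * M := by gcongr
    _ = _ := by ring

end

/-! ### Hölder's inequality and the Strauss exponent -/

section

/-- The cut-off at scale `M` ends at time `M`, so integrals for all scales can be taken over one
fixed slab and then differentiated in the scale. -/
lemma lintegral_slab_eq {n : ℕ} {M M₁ : ℝ} (h : M ≤ M₁) {F : ℝ × Space n → ℝ≥0∞}
    (hF : ∀ z, M < z.1 → F z = 0) : ∫⁻ z, F z ∂(slab n M₁) = ∫⁻ z, F z ∂(slab n M) := by
  have h1 : slab n M = (slab n M₁).restrict (Iic M ×ˢ univ) := by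
    rw [slab, slab, ← Measure.restrict_univ (μ := (volume : Measure (Space n))),
      Measure.prod_restrict, Measure.prod_restrict,
      Measure.restrict_restrict (measurableSet_Iic.prod MeasurableSet.univ), prod_inter_prod,
      univ_inter, inter_comm, Ioc_inter_Iic, min_eq_right h]
  rw [h1]
  refine (setLIntegral_eq_of_support_subset fun z hz => ?_).symm
  exact ⟨not_lt.1 fun hlt => hz (hF z hlt), mem_univ _⟩

lemma IsStraussExponent.one_lt {n : ℕ} {p : ℝ} (hn : 2 ≤ n) (h : IsStraussExponent n p) :
    1 < p := by
  obtain ⟨hp, he⟩ := h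
  have hn' : (2 : ℝ) ≤ n := by exact_mod_cast hn
  by_contra hle
  have hle : p ≤ 1 := not_lt.1 hle
  nlinarith [mul_nonneg (by linarith : (0 : ℝ) ≤ (n : ℝ) - 1) (mul_nonneg hp.le (sub_nonneg.2 hle))]

/-- This is the positivity of `q₁ = (n-1)/2 - 1/p`. -/
lemma IsStraussExponent.two_lt {n : ℕ} {p : ℝ} (hn : 2 ≤ n) (h : IsStraussExponent n p) :
    2 < ((n : ℝ) - 1) * p := by
  obtain ⟨hp, he⟩ := h
  have hn' : (2 : ℝ) ≤ n := by exact_mod_cast hn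
  have : 2 * p < ((n : ℝ) - 1) * p * p := by nlinarith
  exact lt_of_mul_lt_mul_right this hp.le

/-- Hölder's inequality on the light cone, with the weight `waveAvg q₁` for the critical
`q₁ = (n - 1) / 2 - 1 / p`. All powers of `M` balance for the Strauss exponent. -/
lemma exists_lintegral_mul_waveAvg_le {m : ℕ} {p p' q q₁ k R : ℝ} (hpp : p.HolderConjugate p')
    (hp : IsStraussExponent (m + 1) p) (hk : 0 < k) (hR : 0 < R)
    (hq : q = (m : ℝ) / 2 + k / p') (hq₁ : q₁ = (m : ℝ) / 2 - 1 / p) (hq₁0 : 0 ≤ q₁) :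
    ∃ C : ℝ, 0 < C ∧ ∀ (M L : ℝ) (w : ℝ → ℝ) (U : ℝ × Space (m + 1) → ℝ), 1 ≤ M →
      (∀ ρ, 0 ≤ ρ → ρ ≤ M + R → ∫ y in (0 : ℝ)..ρ, (ρ + 1 - y) ^ (-k) ≤ L) →
      Measurable w → (∀ s, 0 ≤ w s) → (∀ s, s ≤ 1 / 2 → w s = 0) → Measurable U →
      (∀ s x, R + s < ‖x‖ → U (s, x) = 0) →
      ∫⁻ z, ENNReal.ofReal (w (z.1 / M) ^ (1 / p) * |U z|) *
          waveAvg q (z.1 + R + 1) z.2 ∂(slab (m + 1) M)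
        ≤ ENNReal.ofReal (C * M * L ^ (1 / p')) *
          (∫⁻ z, ENNReal.ofReal (w (z.1 / M) * |U z| ^ p) *
            waveAvg q₁ (z.1 + R + 1) z.2 ∂(slab (m + 1) M)) ^ (1 / p) := by
  have hp1 := hpp.lt
  have hp'1 := hpp.symm.lt
  have hp0 : 0 < p := by linarith
  have hp'0 : 0 < p' := by linarith
  obtain ⟨C, hC, hI⟩ := exists_lintegral_waveAvg_rpow_le m hp'1 hk hR hq
  obtain ⟨c, hc, hlow⟩ := exists_le_waveAvg (m + 1) q₁
  refine ⟨(c⁻¹ * (R + 2) ^ q₁) ^ (1 / p) * C ^ (1 / p'), by positivity, ?_⟩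
  intro M L w U hM hL hwm hw0 hwz hUm hU0
  have hM0 : 0 < M := by linarith
  have hL0 : 0 ≤ L := by simpa using hL 0 le_rfl (by linarith)
  set S := {z : ℝ × Space (m + 1) | M / 2 ≤ z.1 ∧ ‖z.2‖ ≤ R + z.1} with hS
  have hset : MeasurableSet S :=
    (measurableSet_le measurable_const measurable_fst).inter
      (measurableSet_le (f := fun z : ℝ × Space (m + 1) => ‖z.2‖) (g := fun z => R + z.1)
        (by fun_prop) (by fun_prop))
  have hVm := measurable_waveAvg (n := m + 1) q R
  have hoff : ∀ z ∉ S, w (z.1 / M) = 0 ∨ U z = 0 := by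
    intro z hz
    rw [hS, mem_ofPred_eq, not_and_or, not_le, not_le] at hz
    rcases hz with hz | hz
    · left
      refine hwz _ ?_
      rw [div_le_iff₀ hM0]; linarith
    · exact Or.inr (hU0 z.1 z.2 hz)
  have hp_inv : 1 / p ≠ 0 := by positivity
  have e1 : ∫⁻ z, ENNReal.ofReal (w (z.1 / M) ^ (1 / p) * |U z|) *
          waveAvg q (z.1 + R + 1) z.2 ∂(slab (m + 1) M)
      = ∫⁻ z, ((fun z => ENNReal.ofReal (w (z.1 / M) ^ (1 / p) * |U z|)) *
          S.indicator (fun z => waveAvg q (z.1 + R + 1) z.2)) z ∂(slab (m + 1) M) := by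
    refine lintegral_congr fun z => ?_
    by_cases hz : z ∈ S
    · simp [indicator_of_mem hz]
    · rcases hoff z hz with h | h <;> simp [h, indicator_of_notMem hz, hp0.ne']
  -- The weight `V_{q₁}` is inserted by its lower bound, of order `M^(-q₁)` on the cone; this costs
  -- `M^(q₁)`.
  have e2 : ∫⁻ z, ENNReal.ofReal (w (z.1 / M) ^ (1 / p) * |U z|) ^ p ∂(slab (m + 1) M)
      ≤ ENNReal.ofReal (c⁻¹ * (R + 2) ^ q₁ * M ^ q₁) *
        ∫⁻ z, ENNReal.ofReal (w (z.1 / M) * |U z| ^ p) *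
            waveAvg q₁ (z.1 + R + 1) z.2 ∂(slab (m + 1) M) := by
    rw [← lintegral_const_mul' _ _ ENNReal.ofReal_ne_top]
    refine lintegral_mono_ae ?_
    filter_upwards [ae_slab_mem M] with z hz
    have hwp : 0 ≤ w (z.1 / M) := hw0 _
    rw [ENNReal.ofReal_rpow_of_nonneg (by positivity) hp0.le,
      Real.mul_rpow (by positivity) (abs_nonneg _), ← Real.rpow_mul hwp,
      one_div_mul_cancel hp0.ne', Real.rpow_one]
    by_cases hU : U z = 0
    · simp [hU, hp0.ne']
    have hx : ‖z.2‖ ≤ R + z.1 := by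
      by_contra hlt
      exact hU (hU0 z.1 z.2 (not_le.1 hlt))
    have hA : 0 < z.1 + R + 1 := by linarith [hz.1]
    have hl := hlow (z.1 + R + 1) z.2 hq₁0 (by linarith)
    calc _ = ENNReal.ofReal (c⁻¹ * (R + 2) ^ q₁ * M ^ q₁) *
        (ENNReal.ofReal (w (z.1 / M) * |U z| ^ p) *
          ENNReal.ofReal (c * ((R + 2) * M) ^ (-q₁))) := by
          rw [← ENNReal.ofReal_mul (by positivity), ← ENNReal.ofReal_mul (by positivity)]
          congr 1
          rw [Real.mul_rpow (by positivity) hM0.le, Real.rpow_neg (by positivity),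
            Real.rpow_neg hM0.le]
          field_simp
      _ ≤ _ := by
          gcongr
          refine le_trans (ENNReal.ofReal_le_ofReal ?_) hl
          refine mul_le_mul_of_nonneg_left ?_ hc.le
          exact Real.rpow_le_rpow_of_nonpos hA (by nlinarith [hz.2]) (by linarith)
  have e3 : ∫⁻ z, S.indicator (fun z => waveAvg q (z.1 + R + 1) z.2) z ^ p' ∂(slab (m + 1) M)
      ≤ ENNReal.ofReal (C * (M ^ ((m : ℝ) + 1 - m * p' / 2) * L)) := by
    refine le_trans (le_of_eq ?_) (hI M L hM hL)
    rw [← lintegral_indicator hset]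
    refine lintegral_congr fun z => ?_
    by_cases hz : z ∈ S
    · simp [indicator_of_mem hz]
    · simp [indicator_of_notMem hz, hp'0]
  rw [e1]
  refine (ENNReal.lintegral_mul_le_Lp_mul_Lq _ hpp (by fun_prop)
    (hVm.indicator hset).aemeasurable).trans ?_
  calc _ ≤ (ENNReal.ofReal (c⁻¹ * (R + 2) ^ q₁ * M ^ q₁) *
        ∫⁻ z, ENNReal.ofReal (w (z.1 / M) * |U z| ^ p) *
            waveAvg q₁ (z.1 + R + 1) z.2 ∂(slab (m + 1) M)) ^ (1 / p) *
        (ENNReal.ofReal (C * (M ^ ((m : ℝ) + 1 - m * p' / 2) * L))) ^ (1 / p') := by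
        gcongr
    _ = _ := by
        rw [ENNReal.mul_rpow_of_nonneg _ _ (by positivity),
          ENNReal.ofReal_rpow_of_nonneg (by positivity) (by positivity),
          ENNReal.ofReal_rpow_of_nonneg (by positivity) (by positivity), mul_right_comm,
          ← ENNReal.ofReal_mul (by positivity)]
        congr 2
        rw [Real.mul_rpow (by positivity) (by positivity), Real.mul_rpow hC.le (by positivity),
          Real.mul_rpow (by positivity) hL0, ← Real.rpow_mul hM0.le, ← Real.rpow_mul hM0.le]
        -- With `n = m + 1` this balance of powers is equivalent to the quadratic equation of the
        -- Strauss exponent. It is the place where criticality is used.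
        have hexp : q₁ * (1 / p) + ((m : ℝ) + 1 - m * p' / 2) * (1 / p') = 1 := by
          have hinv : 1 / p' = 1 - 1 / p := by
            have := hpp.inv_add_inv_eq_one
            rw [one_div, one_div]; linarith
          have h2 : ((m : ℝ) + 1 - m * p' / 2) * (1 / p') = (m + 1) * (1 / p') - m / 2 := by
            field_simp
          rw [h2, hinv, hq₁]
          have he := hp.2
          push_cast at he
          field_simp
          linarith
        have hMM : M ^ (q₁ * (1 / p)) * M ^ (((m : ℝ) + 1 - m * p' / 2) * (1 / p')) = M := by
          rw [← Real.rpow_add hM0, hexp, Real.rpow_one]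
        linear_combination (c⁻¹ * (R + 2) ^ q₁) ^ (1 / p) * C ^ (1 / p') * L ^ (1 / p') * hMM

end

/-! ### The logarithmic time variable and the lifespan bound -/

section

lemma waveAvg_le_volume {n : ℕ} {q A : ℝ} {x : Space n} (hq : 0 ≤ q) (hx : ‖x‖ + 1 ≤ A) :
    waveAvg q A x ≤ volume (Metric.ball (0 : Space n) 1) := by
  calc waveAvg q A x ≤ ∫⁻ _ in Metric.ball (0 : Space n) 1, 1 := by
        refine lintegral_mono fun θ => ?_
        rw [← ENNReal.ofReal_one]
        refine ENNReal.ofReal_le_ofReal ?_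
        have h1 := abs_le.1 (abs_inner_direction_le θ x)
        exact Real.rpow_le_one_of_one_le_of_nonpos (by linarith) (by linarith)
    _ = _ := by simp

lemma rpow_le_of_ofReal_le {x B H p : ℝ} (hp : 0 < p) (hx : 0 ≤ x) (hB : 0 ≤ B) (hH : 0 ≤ H)
    (h : ENNReal.ofReal x ≤ ENNReal.ofReal B * (ENNReal.ofReal H) ^ (1 / p)) :
    x ^ p ≤ B ^ p * H := by
  rw [ENNReal.ofReal_rpow_of_nonneg hH (by positivity), ← ENNReal.ofReal_mul hB,
    ENNReal.ofReal_le_ofReal_iff (by positivity)] at h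
  calc x ^ p ≤ (B * H ^ (1 / p)) ^ p := by gcongr
    _ = B ^ p * H := by
      rw [Real.mul_rpow hB (by positivity), ← Real.rpow_mul hH, one_div_mul_cancel hp.ne',
        Real.rpow_one]

/-- The weighted space-time integral of a function `g` against the cut-off `η (s / e^τ)` is
differentiable in `τ`. -/
lemma hasDerivAt_integral_cutoff {n : ℕ} {p C M₁ : ℝ} {η w w' w'' : ℝ → ℝ}
    (hη : IsCutoff p C η w w' w'') {g : ℝ × Space n → ℝ} (hg : Integrable g (slab n M₁)) (τ : ℝ) :
    HasDerivAt (fun τ => ∫ z, η (z.1 / Real.exp τ) * g z ∂(slab n M₁))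
      (∫ z, z.1 / Real.exp τ * w (z.1 / Real.exp τ) * g z ∂(slab n M₁)) τ := by
  have hηc := hη.contDiff.continuous
  have hwc := hη.contDiff_w.continuous
  have hηm : ∀ τ, Continuous fun z : ℝ × Space n => η (z.1 / Real.exp τ) := fun τ =>
    hηc.comp (continuous_fst.div_const _)
  have hwm : Continuous fun z : ℝ × Space n => z.1 / Real.exp τ * w (z.1 / Real.exp τ) :=
    (continuous_fst.div_const _).mul (hwc.comp (continuous_fst.div_const _))
  have hint : Integrable (fun z => η (z.1 / Real.exp τ) * g z) (slab n M₁) := by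
    obtain ⟨B, hB⟩ := isCompact_Icc.exists_bound_of_continuousOn (s := Icc 0 M₁)
      (hηc.comp (continuous_id.div_const (Real.exp τ))).continuousOn
    refine hg.bdd_mul (c := B) (hηm τ).aestronglyMeasurable ?_
    filter_upwards [ae_slab_mem M₁] with z hz
    exact hB z.1 ⟨hz.1.le, hz.2⟩
  refine (hasDerivAt_integral_of_dominated_loc_of_deriv_le (μ := slab n M₁)
    (F := fun τ z => η (z.1 / Real.exp τ) * g z)
    (F' := fun τ z => z.1 / Real.exp τ * w (z.1 / Real.exp τ) * g z)
    (bound := fun z => |g z|) (s := univ) Filter.univ_mem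
    (Filter.Eventually.of_forall fun τ => (hηm τ).aestronglyMeasurable.mul hg.aestronglyMeasurable)
    hint (hwm.aestronglyMeasurable.mul hg.aestronglyMeasurable) ?_ hg.abs ?_).2
  · filter_upwards [ae_slab_mem M₁] with z hz σ _
    rw [norm_mul, Real.norm_eq_abs, Real.norm_eq_abs]
    refine mul_le_of_le_one_left (abs_nonneg _) ?_
    have hy : 0 ≤ z.1 / Real.exp σ := div_nonneg hz.1.le (Real.exp_pos _).le
    rw [abs_of_nonneg (mul_nonneg hy (hη.w_nonneg _))]
    rcases le_total (z.1 / Real.exp σ) 1 with h | h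
    · exact mul_le_one₀ h (hη.w_nonneg _) (hη.w_le_one _)
    · rw [hη.w_eq_zero_of_ge _ h]; simp
  · refine Filter.Eventually.of_forall fun z σ _ => ?_
    have h1 : HasDerivAt (fun σ => z.1 / Real.exp σ) (-(z.1 / Real.exp σ)) σ := by
      have := ((Real.hasDerivAt_exp σ).fun_inv (Real.exp_pos σ).ne').const_mul z.1
      refine (this.congr_deriv ?_)
      field_simp
    have h2 := ((hη.hasDerivAt (z.1 / Real.exp σ)).comp σ h1).mul_const (g z)
    refine h2.congr_deriv ?_
    ring

variable {n : ℕ} {β p : ℝ} {u₀ : H2 n} {u₁ : H1 n}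

/-- Upper bound for the times up to which an energy solution exists. -/
lemma exists_time_le (hn : 2 ≤ n) (hp : IsStraussExponent n p) (hβ : 0 < β) {R : ℝ} (hR : 0 < R)
    (hu₀ : Nonneg u₀.toL2) (hu₀s : SupportedInBall R u₀.toL2) (hu₀0 : u₀.toL2 ≠ 0)
    (hu₁ : Nonneg u₁.toL2) :
    ∃ C : ℝ, 0 < C ∧ ∀ (ε : ℝ) (u₂ : L2 n) (T : EReal) (u : ℝ → H2 n) (M₁ : ℝ), 0 < ε → ε ≤ 1 →
      Nonneg (u₂ - u₀.laplacian) → IsEnergySolution β p ε u₀ u₁ u₂ T u →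
      (∀ t : ℝ, 0 < t → (t : EReal) < T → SupportedInBall (R + t) (u t).toL2) →
      0 < M₁ → (M₁ : EReal) < T → M₁ ≤ Real.exp (C * ε ^ (-(p * (p - 1)))) := by
  obtain ⟨m, rfl⟩ : ∃ m, n = m + 1 := ⟨n - 1, by omega⟩
  have hp1 := hp.one_lt hn
  have hp2 := hp.two_lt hn
  push_cast at hp2
  rw [add_sub_cancel_right] at hp2
  have hp0 : 0 < p := by linarith
  let p' := p.conjExponent
  have hpp : p.HolderConjugate p' := Real.HolderConjugate.conjExponent hp1
  have hp'0 : 0 < p' := hpp.symm.pos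
  have hinv : 1 / p' = 1 - 1 / p := by
    have := hpp.inv_add_inv_eq_one
    rw [one_div, one_div]; linarith
  let q₁ : ℝ := (m : ℝ) / 2 - 1 / p
  have hq₁0 : 0 < q₁ := by
    have : 1 / p < (m : ℝ) / 2 := by
      rw [div_lt_div_iff₀ hp0 (by norm_num)]; linarith
    exact sub_pos.2 this
  -- `q₂ + 1 = m/2 + 2/p'` is the case `k = 2`, without a logarithm. It is used only for the data
  -- term, so its weight on the left does not matter.
  let q₂ : ℝ := (m : ℝ) / 2 + 2 / p' - 1
  have hq₂0 : 0 < q₂ := by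
    have h1 : 1 / p < 1 := by rw [div_lt_one hp0]; exact hp1
    have : q₂ = q₁ + (1 - 1 / p) := by
      have : 2 / p' = 2 * (1 / p') := by ring
      simp only [q₁, q₂]
      rw [this, hinv]; ring
    linarith
  obtain ⟨η, w, w', w'', C, hη⟩ := exists_isCutoff hp1
  obtain ⟨a₁, a₂, a₃, ha₁, ha₂, ha₃, hA⟩ :=
    exists_lintegral_waveAvg_le hβ hp1 hn hq₁0 hR hu₀ hu₀s hu₀0 hu₁ hη
  obtain ⟨b₁, b₂, b₃, hb₁, hb₂, hb₃, hB⟩ :=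
    exists_lintegral_waveAvg_le hβ hp1 hn hq₂0 hR hu₀ hu₀s hu₀0 hu₁ hη
  obtain ⟨c₁, hc₁, hH₁⟩ := exists_lintegral_mul_waveAvg_le hpp hp (q := q₁ + 1) (q₁ := q₁) (k := 1)
    one_pos hR (by rw [hinv]; ring) rfl hq₁0.le
  obtain ⟨c₂, hc₂, hH₂⟩ := exists_lintegral_mul_waveAvg_le hpp hp (q := q₂ + 1) (q₁ := q₁) (k := 2)
    two_pos hR (by simp only [q₂]; ring) rfl hq₁0.le
  -- Chosen so that `log (R+2) + τ ≤ κ τ` for `τ ≥ 1`.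
  let κ : ℝ := 1 + Real.log (R + 2)
  have hκ : 0 < κ := by
    have := Real.log_pos (by linarith : 1 < R + 2)
    simp only [κ]; linarith
  let B₁ : ℝ := a₃ * (c₁ * κ ^ (1 / p')) / a₂
  let B₂ : ℝ := b₃ * c₂ / b₁
  have hB₁ : 0 < B₁ := by positivity
  have hB₂ : 0 < B₂ := by positivity
  let a : ℝ := min ((2 * B₁ ^ p)⁻¹) ((2 * B₂ ^ p)⁻¹)
  have ha : 0 < a := by positivity
  obtain ⟨D, hD, hode⟩ := exists_le_of_deriv_ge_rpow (τ₀ := 1) hp1 ha one_pos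
  refine ⟨4 + D, by positivity, ?_⟩
  intro ε u₂ T u M₁ hε hε1 hu₂ h hsupp hM₁0 hM₁
  rw [← Real.log_le_iff_le_exp hM₁0]
  obtain ⟨U, hU⟩ := h.exists_isRepresentative hp0 hM₁0 hM₁ hsupp
  have hUm := hU.measurable
  have hVm := measurable_waveAvg (n := m + 1) q₁ R
  -- Passing to real values loses nothing: wherever `U` is nonzero, `V_{q₁}` is at most the volume
  -- of the unit ball.
  let g : ℝ × Space (m + 1) → ℝ := fun z => |U z| ^ p * (waveAvg q₁ (z.1 + R + 1) z.2).toReal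
  have hg0 : ∀ z, 0 ≤ g z := fun z => by positivity
  have hUsupp : ∀ z, U z ≠ 0 → ‖z.2‖ ≤ R + z.1 := fun z hz =>
    not_lt.1 fun hlt => hz (hU.eq_zero z.1 z.2 hlt)
  have hVle : ∀ z, U z ≠ 0 →
      waveAvg q₁ (z.1 + R + 1) z.2 ≤ volume (Metric.ball (0 : Space (m + 1)) 1) := fun z hz =>
    waveAvg_le_volume hq₁0.le (by linarith [hUsupp z hz])
  have hg : Integrable g (slab (m + 1) M₁) := by
    refine (hU.integrable.mul_const
      (volume (Metric.ball (0 : Space (m + 1)) 1)).toReal).mono' (by fun_prop) ?_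
    refine Filter.Eventually.of_forall fun z => ?_
    rw [Real.norm_of_nonneg (hg0 z)]
    by_cases hz : U z = 0
    · simp [g, hz, hp0.ne']
    · simp only [g]
      gcongr
      · exact measure_ball_lt_top.ne
      · exact hVle z hz
  have hgV : ∀ (c : ℝ) z, 0 ≤ c →
      ENNReal.ofReal (c * |U z| ^ p) * waveAvg q₁ (z.1 + R + 1) z.2 = ENNReal.ofReal (c * g z) := by
    intro c z hc
    by_cases hz : U z = 0
    · simp [g, hz, hp0.ne']
    · have hfin := ((hVle z hz).trans_lt measure_ball_lt_top).ne
      rw [← ENNReal.ofReal_toReal hfin, ← ENNReal.ofReal_mul (by positivity)]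
      simp only [g, mul_assoc]
  let Z : ℝ → ℝ := fun τ => ∫ z, η (z.1 / Real.exp τ) * g z ∂(slab (m + 1) M₁)
  let Z' : ℝ → ℝ := fun τ => ∫ z, z.1 / Real.exp τ * w (z.1 / Real.exp τ) * g z ∂(slab (m + 1) M₁)
  let H : ℝ → ℝ := fun τ => ∫ z, w (z.1 / Real.exp τ) * g z ∂(slab (m + 1) M₁)
  have hηm : Measurable η := hη.contDiff.continuous.measurable
  have hwm : Measurable w := hη.contDiff_w.continuous.measurable
  have hy0 : ∀ τ, ∀ᵐ z ∂(slab (m + 1) M₁), 0 ≤ z.1 / Real.exp τ := fun τ => by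
    filter_upwards [ae_slab_mem M₁] with z hz
    exact div_nonneg hz.1.le (Real.exp_pos _).le
  have hwi : ∀ τ, Integrable (fun z => w (z.1 / Real.exp τ) * g z) (slab (m + 1) M₁) := fun τ =>
    hg.bdd_mul (c := 1) (hwm.comp (measurable_fst.div_const _)).aestronglyMeasurable
      (Filter.Eventually.of_forall fun z => by
      rw [Real.norm_of_nonneg (hη.w_nonneg _)]; exact hη.w_le_one _)
  have hηi : ∀ τ, Integrable (fun z => η (z.1 / Real.exp τ) * g z) (slab (m + 1) M₁) := fun τ => by
    obtain ⟨B, hB⟩ := isCompact_Icc.exists_bound_of_continuousOn (s := Icc 0 M₁)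
      (hη.contDiff.continuous.comp (continuous_id.div_const (Real.exp τ))).continuousOn
    refine hg.bdd_mul (c := B) (hηm.comp (measurable_fst.div_const _)).aestronglyMeasurable ?_
    filter_upwards [ae_slab_mem M₁] with z hz
    exact hB z.1 ⟨hz.1.le, hz.2⟩
  have hwi' : ∀ τ, Integrable (fun z => z.1 / Real.exp τ * w (z.1 / Real.exp τ) * g z)
      (slab (m + 1) M₁) := fun τ => by
    simp only [mul_assoc]
    refine (hwi τ).bdd_mul (c := M₁ / Real.exp τ) (by fun_prop) ?_
    filter_upwards [ae_slab_mem M₁] with z hz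
    rw [Real.norm_of_nonneg (div_nonneg hz.1.le (Real.exp_pos _).le)]
    have := hz.2
    gcongr
  have hZ0 : ∀ τ, 0 ≤ Z τ := fun τ => integral_nonneg_of_ae (by
    filter_upwards [hy0 τ] with z hz
    exact mul_nonneg (hη.nonneg _ hz) (hg0 z))
  have hH0 : ∀ τ, 0 ≤ H τ := fun τ =>
    integral_nonneg fun z => mul_nonneg (hη.w_nonneg _) (hg0 z)
  -- `Z'` has the extra factor `s/e^τ`, which is at least `1/2` wherever `w` does not vanish.
  have hHZ : ∀ τ, H τ / 2 ≤ Z' τ := by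
    intro τ
    rw [div_eq_inv_mul, ← integral_const_mul]
    refine integral_mono ((hwi τ).const_mul _) (hwi' τ) fun z => ?_
    rw [← mul_assoc]
    refine mul_le_mul_of_nonneg_right ?_ (hg0 z)
    by_cases hy : z.1 / Real.exp τ ≤ 1 / 2
    · rw [hη.w_eq_zero_of_le _ hy]; simp
    · refine mul_le_mul_of_nonneg_right ?_ (hη.w_nonneg _)
      linarith [not_le.1 hy]
  have hkey : ∀ τ ∈ Icc 1 (Real.log M₁), (b₁ * ε / (b₃ * c₂)) ^ p ≤ H τ ∧
      Z τ ^ p ≤ (B₁ * τ ^ (1 / p')) ^ p * H τ := by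
    intro τ hτ
    have hτ0 : 0 < τ := one_pos.trans_le hτ.1
    have hM0 : 0 < Real.exp τ := Real.exp_pos τ
    have hM1 : 1 ≤ Real.exp τ := Real.one_le_exp hτ0.le
    have hMM : Real.exp τ ≤ M₁ := (Real.le_log_iff_exp_le hM₁0).1 hτ.2
    have hMT : (Real.exp τ : EReal) < T := (EReal.coe_le_coe_iff.2 hMM).trans_lt hM₁
    have hUM := hU.mono hMM
    have hlarge : ∀ z : ℝ × Space (m + 1), Real.exp τ < z.1 → 1 ≤ z.1 / Real.exp τ := fun z hz =>
      (one_le_div hM0).2 hz.le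
    have hHe : ∫⁻ z, ENNReal.ofReal (w (z.1 / Real.exp τ) * |U z| ^ p) *
        waveAvg q₁ (z.1 + R + 1) z.2 ∂(slab (m + 1) (Real.exp τ)) = ENNReal.ofReal (H τ) := by
      rw [← lintegral_slab_eq hMM fun z hz => by rw [hη.w_eq_zero_of_ge _ (hlarge z hz)]; simp,
        ofReal_integral_eq_lintegral_ofReal (hwi τ)
          (Filter.Eventually.of_forall fun z => mul_nonneg (hη.w_nonneg _) (hg0 z))]
      exact lintegral_congr fun z => hgV _ z (hη.w_nonneg _)
    have hZe : ∫⁻ z, ENNReal.ofReal (η (z.1 / Real.exp τ) * |U z| ^ p) *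
        waveAvg q₁ (z.1 + R + 1) z.2 ∂(slab (m + 1) (Real.exp τ)) = ENNReal.ofReal (Z τ) := by
      rw [← lintegral_slab_eq hMM fun z hz => by rw [hη.eq_zero _ (hlarge z hz)]; simp,
        ofReal_integral_eq_lintegral_ofReal (hηi τ) (by
          filter_upwards [hy0 τ] with z hz
          exact mul_nonneg (hη.nonneg _ hz) (hg0 z))]
      refine lintegral_congr_ae ?_
      filter_upwards [hy0 τ] with z hz
      exact hgV _ z (hη.nonneg _ hz)
    constructor
    · refine (rpow_le_of_ofReal_le (B := 1) hp0 (by positivity) zero_le_one (hH0 τ) ?_).trans_eq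
        (by rw [Real.one_rpow, one_mul])
      have h2 := hH₂ (Real.exp τ) 1 w U hM1 (fun ρ hρ _ => integral_inv_sq_le hρ) hwm hη.w_nonneg
        hη.w_eq_zero_of_le hUm hU.eq_zero
      rw [hHe, Real.one_rpow, mul_one] at h2
      -- The nonlinear term is discarded and the data term kept.
      have h1 := (le_self_add.trans (hB ε u₂ T u _ U hε hu₂ h hM1 hMT hUM)).trans
        (mul_le_mul' le_rfl h2)
      rw [← mul_assoc, ← ENNReal.ofReal_mul (by positivity)] at h1
      have e : b₃ / Real.exp τ * (c₂ * Real.exp τ) = b₃ * c₂ := by field_simp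
      rw [e] at h1
      rw [ENNReal.ofReal_one, one_mul, ENNReal.ofReal_div_of_pos (by positivity)]
      exact ENNReal.div_le_of_le_mul' h1
    · refine rpow_le_of_ofReal_le hp0 (hZ0 τ) (by positivity) (hH0 τ) ?_
      have hlog : ∀ ρ, 0 ≤ ρ → ρ ≤ Real.exp τ + R →
          ∫ y in (0 : ℝ)..ρ, (ρ + 1 - y) ^ (-1 : ℝ) ≤ κ * τ := by
        intro ρ hρ hρM
        calc _ ≤ Real.log (ρ + 1) := integral_inv_le hρ
          _ ≤ Real.log ((R + 2) * Real.exp τ) := by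
            refine Real.log_le_log (by linarith) ?_
            nlinarith
          _ = Real.log (R + 2) + τ := by
            rw [Real.log_mul (by linarith) hM0.ne', Real.log_exp]
          _ ≤ κ * τ := by
            have := Real.log_pos (by linarith : 1 < R + 2)
            have := hτ.1
            simp only [κ]
            nlinarith
      have h2 := hH₁ (Real.exp τ) (κ * τ) w U hM1 hlog hwm hη.w_nonneg
        hη.w_eq_zero_of_le hUm hU.eq_zero
      rw [hHe] at h2
      -- Now the data term is discarded and the nonlinear term kept.
      have h1 := (le_add_self.trans (hA ε u₂ T u _ U hε hu₂ h hM1 hMT hUM)).trans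
        (mul_le_mul' le_rfl h2)
      rw [hZe, ← mul_assoc, ← ENNReal.ofReal_mul (p := a₃ / Real.exp τ) (by positivity)] at h1
      have e : B₁ * τ ^ (1 / p') =
          a₃ / Real.exp τ * (c₁ * Real.exp τ * (κ * τ) ^ (1 / p')) / a₂ := by
        rw [Real.mul_rpow hκ.le hτ0.le]
        simp only [B₁]
        field_simp
      rw [e, ENNReal.ofReal_div_of_pos ha₂, div_eq_mul_inv, mul_right_comm, ← div_eq_mul_inv]
      exact (ENNReal.le_div_iff_mul_le (Or.inl (by simpa using ha₂))
        (Or.inl ENNReal.ofReal_ne_top)).2 (by rwa [mul_comm])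
  -- With `δ = ε^p`, the bound `δ^(1-p)` is exactly `ε^(-p(p-1))`.
  refine (hode (ε ^ p) (Real.log M₁) Z Z' (by positivity)
    (fun τ _ => hasDerivAt_integral_cutoff hη hg τ) (fun τ _ => hZ0 τ) ?_ ?_).trans ?_
  · intro τ hτ
    refine le_trans ?_ (hHZ τ)
    have e : b₁ * ε / (b₃ * c₂) = ε / B₂ := by
      simp only [B₂]
      field_simp
    have h1 := (hkey τ hτ).1
    rw [e, Real.div_rpow hε.le hB₂.le] at h1
    calc a * ε ^ p ≤ (2 * B₂ ^ p)⁻¹ * ε ^ p := by gcongr; exact min_le_right _ _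
      _ = ε ^ p / B₂ ^ p / 2 := by field_simp
      _ ≤ H τ / 2 := by gcongr
  · intro τ hτ
    have hτ0 : 0 < τ := one_pos.trans_le hτ.1
    refine le_trans ?_ (hHZ τ)
    have h1 := (hkey τ hτ).2
    have e : (τ ^ (1 / p')) ^ p = τ ^ (p - 1) := by
      rw [← Real.rpow_mul hτ0.le, hinv, sub_mul, one_div_mul_cancel hp0.ne', one_mul]
    have e' : τ ^ (1 - p) * τ ^ (p - 1) = 1 := by
      rw [← Real.rpow_add hτ0]
      simp
    rw [Real.mul_rpow hB₁.le (by positivity), e] at h1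
    calc a * τ ^ (1 - p) * Z τ ^ p ≤
        (2 * B₁ ^ p)⁻¹ * τ ^ (1 - p) * (B₁ ^ p * τ ^ (p - 1) * H τ) := by
          have := Real.rpow_nonneg (hZ0 τ) p
          gcongr
          exact min_le_left _ _
      _ = (2 * B₁ ^ p)⁻¹ * B₁ ^ p * (τ ^ (1 - p) * τ ^ (p - 1)) * H τ := by ring
      _ = H τ / 2 := by
        rw [e']
        field_simp
  · have e1 : (ε ^ p) ^ (1 - p) = ε ^ (-(p * (p - 1))) := by
      rw [← Real.rpow_mul hε.le]; congr 1; ring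
    have e2 : 1 ≤ ε ^ (-(p * (p - 1))) :=
      Real.one_le_rpow_of_pos_of_le_one_of_nonpos hε hε1
        (neg_nonpos.2 (mul_nonneg hp0.le (by linarith)))
    rw [e1]
    -- Since `ε ≤ 1`, the power of `ε` is at least `1` and absorbs the constant alternative `4`.
    refine max_le ?_ ?_ <;> nlinarith

end

end MGT

end

theorem theorem5p1 (n : ℕ) (hn : 2 ≤ n) (p : ℝ) (hp : MGT.IsStraussExponent n p)
    (β : ℝ) (hβ : 0 < β) (R : ℝ) (hR : 0 < R) (u₀ : MGT.H2 n) (u₁ : MGT.H1 n)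
    (hu₀_nonneg : MGT.Nonneg u₀.toL2) (hu₀_supp : MGT.SupportedInBall R u₀.toL2)
    (hu₀_ne : u₀.toL2 ≠ 0)
    (hu₁_nonneg : MGT.Nonneg u₁.toL2) (hu₁_supp : MGT.SupportedInBall R u₁.toL2) :
    ∃ ε₀ : ℝ, 0 < ε₀ ∧
      ∀ u₂ : MGT.L2 n, MGT.Nonneg u₂ → MGT.SupportedInBall R u₂ →
        MGT.Nonneg (u₂ - u₀.laplacian) →
        ∃ C : ℝ, 0 < C ∧
          ∀ ε : ℝ, 0 < ε → ε ≤ ε₀ →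
            ∀ T : EReal, 0 < T →
              ∀ u : ℝ → MGT.H2 n, MGT.IsEnergySolution β p ε u₀ u₁ u₂ T u →
                (∀ t : ℝ, 0 < t → (t : EReal) < T → MGT.SupportedInBall (R + t) (u t).toL2) →
                T < ⊤ ∧ T ≤ ((Real.exp (C * ε ^ (-(p * (p - 1)))) : ℝ) : EReal) := by
  obtain ⟨C, hC, hmain⟩ := MGT.exists_time_le hn hp hβ hR hu₀_nonneg hu₀_supp hu₀_ne hu₁_nonneg
  -- The constant `C` was obtained before `u₂` is introduced, and `ε ≤ 1` is the only smallness
  -- used.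
  refine ⟨1, one_pos, fun u₂ _ _ hu₂ => ⟨C, hC, fun ε hε hε1 T _ u h hsupp => ?_⟩⟩
  have hT : T ≤ ((Real.exp (C * ε ^ (-(p * (p - 1)))) : ℝ) : EReal) := by
    by_contra! hlt
    -- A real time `M < T` beyond the bound contradicts it; this covers `T = ∞` as well.
    obtain ⟨M, hM, hMT⟩ := EReal.lt_iff_exists_real_btwn.1 hlt
    rw [EReal.coe_lt_coe_iff] at hM
    exact hM.not_ge (hmain ε u₂ T u M hε hε1 hu₂ h hsupp ((Real.exp_pos _).trans hM) hMT)
  exact ⟨hT.trans_lt (EReal.coe_lt_top _), hT⟩
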